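/- For a $g$-tuple $A=(A_1,\dots,A_g)$ of real symmetric $d\times d$ matrices, the free spectrahedron $\mathcal D_A$ is the set of all $g$-tuples $X=(X_1,\dots,X_g)$ of real symmetric $n\times n$ matrices, $n\ge 1$ arbitrary, such that $L_A(X)=I+\sum_i A_i\otimes X_i\succeq 0$. A free quadrilateral is a free spectrahedron $\mathcal Q$ in two variables such that $\mathcal Q=\mathcal D_B$ for some pair $B=(B_1,B_2)$ of diagonal real $4\times4$ matrices, and such that its first level $\mathcal Q(1)\subset\mathbb R^2$ is a (bounded, nondegenerate) quadrilateral, i.e. the convex hull of four points none of which lies in the convex hull of the other three. A tuple $X\in\mathcal D_A$ is in the Arveson boundary $\partial^{\mathrm{Arv}}\mathcal D_A$ if, for all matrix tuples $\beta,\gamma$ of compatible sizes, $\begin{pmatrix}X&\beta\\ \beta^T&\gamma\end{pmatrix}\in\mathcal D_A$ implies $\beta=0$. A tuple $X\in\mathcal D_A$ of $n\times n$ matrices is a free extreme point of $\mathcal D_A$ if whenever $X=\sum_{j=1}^k V_j^TY^jV_j$ with $\sum_j V_j^TV_j=I_n$, $Y^j\in\mathcal D_A$ of size $n_j$ and $V_j\ne0$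 for all $j$, then for every $j$ either $n_j=n$ and $Y^j$ is unitarily equivalent to $X$ (that is, $Y^j=U^TXU$ for a real orthogonal matrix $U$), or $n_j>n$ and $Y^j$ is unitarily equivalent to $X\oplus Z$ for some $Z\in\mathcal D_A$. A tuple $X$ is irreducible if $\{0\}$ and $\mathbb R^n$ are the only subspaces $N$ of $\mathbb R^n$ such that $N$ and $N^\perp$ are invariant under every $X_i$. **Theorem.** Let $\mathcal D_A$ be a free quadrilateral. Then there exist noncommutative polynomials $p_1,p_2,p_3,p_4\in\mathbb R\langle x_1,x_2\rangle$ of degree at most three such that, for every $n\ge1$ and every pair $X=(X_1,X_2)$ of real $n\times n$ matrices: 1. $X\in\partial^{\mathrm{Arv}}\mathcal D_A$ if and only if $X\in\mathcal D_A$ and $p_i(X)=0$ for $i=1,\dots,4$; 2. $X$ is a free extreme point of $\mathcal D_A$ if and only if $X\in\mathcal D_A$, $p_i(X)=0$ for $i=1,\dots,4$, and $X$ is irreducible. -/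

import Mathlib

open scoped Matrix Kronecker

noncomputable section

namespace FreeQuad

/-- A `g`-tuple of real `n × n` matrices. (Symmetry is imposed where it is needed.) -/
abbrev MatTuple (g n : ℕ) : Type := Fin g → Matrix (Fin n) (Fin n) ℝ

/-- A dimension-free set of `g`-tuples: one set of tuples for every matrix size `n`. -/
abbrev FreeSet (g : ℕ) : Type := ∀ n : ℕ, Set (MatTuple g n)

/-- `L_A(X) = I + A₁ ⊗ X₁ + ⋯ + A_g ⊗ X_g`, the evaluation of the monic linear pencil. -/
def monicPencil {g d n : ℕ} (A : MatTuple g d) (X : MatTuple g n) :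
    Matrix (Fin d × Fin n) (Fin d × Fin n) ℝ :=
  1 + ∑ i, A i ⊗ₖ X i

/-- The free spectrahedron `D_A`: tuples of symmetric matrices `X`, of any size, such that
`L_A(X)` is positive semidefinite. -/
def freeSpectrahedron {g d : ℕ} (A : MatTuple g d) : FreeSet g :=
  fun _ => {X | (∀ i, (X i).IsSymm) ∧ (monicPencil A X).PosSemidef}

/-- Level one of a free set, as a subset of `ℝ^g`. -/
def levelOne {g : ℕ} (K : FreeSet g) : Set (Fin g → ℝ) :=
  {x | (fun i => Matrix.of fun _ _ => x i : MatTuple g 1) ∈ K 1}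

/-- A (closed, solid, convex, nondegenerate) quadrilateral in the plane: the convex hull of four
points in convex position, i.e. none of the four lies in the convex hull of the other three.
In particular it is bounded and no three of the vertices are collinear. -/
def IsQuadrilateral (S : Set (Fin 2 → ℝ)) : Prop :=
  ∃ v : Fin 4 → (Fin 2 → ℝ), ConvexIndependent ℝ v ∧ S = convexHull ℝ (Set.range v)

/-- A free quadrilateral: a free spectrahedron in two variables which can be defined by a pair of
diagonal `4 × 4` matrices, and whose first level is a quadrilateral. -/
def IsFreeQuadrilateral (K : FreeSet 2) : Prop :=
  IsQuadrilateral (levelOne K) ∧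
    ∃ A : MatTuple 2 4, (∀ i, (A i).IsDiag) ∧ K = freeSpectrahedron A

/-- The tuple of block matrices `(X_i, β_i; β_iᵀ, γ_i)`. -/
def blockTuple {g n m : ℕ} (X : MatTuple g n) (β : Fin g → Matrix (Fin n) (Fin m) ℝ)
    (γ : MatTuple g m) : MatTuple g (n + m) :=
  fun i => Matrix.reindex finSumFinEquiv finSumFinEquiv
    (Matrix.fromBlocks (X i) (β i) (β i)ᵀ (γ i))

/-- The direct sum `X ⊕ Z`. -/
def directSum {g n m : ℕ} (X : MatTuple g n) (Z : MatTuple g m) : MatTuple g (n + m) :=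
  blockTuple X 0 Z

/-- The Arveson boundary: those `X ∈ K` such that `(X, β; βᵀ, γ) ∈ K` forces `β = 0`. -/
def arvesonBoundary {g : ℕ} (K : FreeSet g) : FreeSet g :=
  fun n => {X | X ∈ K n ∧
    ∀ (m : ℕ) (β : Fin g → Matrix (Fin n) (Fin m) ℝ) (γ : MatTuple g m),
      blockTuple X β γ ∈ K (n + m) → β = 0}

/-- `Uᵀ X U = Y` for an orthogonal matrix `U`. (The two conditions on `U` force `n = n'`; two
size variables are used so that no cast is needed.) -/
def UnitarilyEquivalent {g n n' : ℕ} (X : MatTuple g n) (Y : MatTuple g n') : Prop :=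
  ∃ U : Matrix (Fin n) (Fin n') ℝ, Uᵀ * U = 1 ∧ U * Uᵀ = 1 ∧ ∀ i, Uᵀ * X i * U = Y i

/-- Free extreme points: whenever `X` is a matrix convex combination `∑ V_jᵀ Y^j V_j` of elements
`Y^j ∈ K` with all `V_j ≠ 0`, every `Y^j` is unitarily equivalent to `X`, or is larger than `X` and
unitarily equivalent to `X ⊕ Z` for some `Z ∈ K`. -/
def freeExtremePoints {g : ℕ} (K : FreeSet g) : FreeSet g :=
  fun n => {X | X ∈ K n ∧
    ∀ (k : ℕ) (s : Fin k → ℕ) (Y : (j : Fin k) → MatTuple g (s j))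
      (V : (j : Fin k) → Matrix (Fin (s j)) (Fin n) ℝ),
      (∀ j, Y j ∈ K (s j)) → (∀ j, V j ≠ 0) → ∑ j, (V j)ᵀ * V j = 1 →
      (∀ i, X i = ∑ j, (V j)ᵀ * Y j i * V j) →
      ∀ j, (s j = n ∧ UnitarilyEquivalent X (Y j)) ∨
        (n < s j ∧ ∃ (m : ℕ) (Z : MatTuple g m), Z ∈ K m ∧
          UnitarilyEquivalent (directSum X Z) (Y j))}

/-- `N` is a reducing subspace for `M`: both `N` and its orthogonal complement are invariant. -/
def IsReducing {n : ℕ} (M : Matrix (Fin n) (Fin n) ℝ)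
    (N : Submodule ℝ (EuclideanSpace ℝ (Fin n))) : Prop :=
  (∀ v ∈ N, Matrix.toEuclideanLin M v ∈ N) ∧ (∀ v ∈ Nᗮ, Matrix.toEuclideanLin M v ∈ Nᗮ)

/-- A tuple is irreducible if its entries have no common reducing subspace other than the two
trivial ones. -/
def IsIrreducible {g n : ℕ} (X : MatTuple g n) : Prop :=
  ∀ N : Submodule ℝ (EuclideanSpace ℝ (Fin n)), (∀ i, IsReducing (X i) N) → N = ⊥ ∨ N = ⊤

/-- Noncommutative polynomials with real coefficients in `g` variables. -/
abbrev NCPoly (g : ℕ) : Type := FreeAlgebra ℝ (Fin g)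

/-- The degree of a noncommutative polynomial: the largest length of a word which occurs in it
with nonzero coefficient (`0` for the zero polynomial). -/
def NCPoly.degree {g : ℕ} (p : NCPoly g) : ℕ :=
  (FreeAlgebra.equivMonoidAlgebraFreeMonoid p).coeff.support.sup FreeMonoid.length

/-- The evaluation `p(X)`, replacing `x_i` by `X_i`. -/
def NCPoly.eval {g n : ℕ} (p : NCPoly g) (X : MatTuple g n) : Matrix (Fin n) (Fin n) ℝ :=
  FreeAlgebra.lift ℝ X p

end FreeQuad

end

/-! The proof combines a fact about all free spectrahedra with a computation for quadrilaterals. In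
positive size, the free extreme points of any free spectrahedron are the irreducible points of its
Arveson boundary (`mem_freeExtremePoints_iff`), so only the Arveson boundary needs polynomials.

Scale the four edge forms `L j` to take the value 1 where the diagonals meet. Then opposite forms
have a common sum `S = L 0 + L 2 = L 1 + L 3`, and `1 = a L 0 + b L 1 + c S` with `a + b + 2c = 1`.
On the spectrahedron `S` is positive definite; put `G = S⁻¹`. A point lies in the Arveson boundary
iff `L 0 G L 2 = 0` and `L 1 G L 3 = 0`: after congruence by `S^(-1/2)`, opposite forms become
complementary projections. Positivity of a dilation confines each off-diagonal block to the range of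
`L j`, and complementarity with the linear relations kills it; if complementarity fails, an explicit
one-column dilation exists.

The inverse `G` must still be removed. Under both conditions `M = G L 0` and `N = G L 1` are
idempotents with `G = aM + bN + c`, and `G(1 - G)` commutes with both. This trades `S` for `1 - G`
and yields the cubic `L 0 (κ L 3 + ρ L 1) L 2 = 0`, where `κ = c(a + c)` and `ρ = κ + b = (b + c)(a
+ b + c)`. Conversely `W = κ L 3 + ρ L 1` is positive definite and `R = L 0 G L 2` is symmetric with
`R W R = 0`, so `R = 0`. This cubic and the one with the two opposite pairs exchanged cut out the
Arveson boundary. -/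

namespace FreeQuad

/-! ### Free extreme points are the irreducible Arveson boundary points. -/

section MatrixConvexity

variable {g d n : ℕ}

/-- Free spectrahedra are matrix convex and contain `0`: they are closed under matrix convex
combinations with `∑ Cⱼᵀ Cⱼ ≤ 1`. -/
theorem freeSpectrahedron_sum_compress (A : MatTuple g d) {k : ℕ} {s : Fin k → ℕ}
    {Y : (j : Fin k) → MatTuple g (s j)} (hY : ∀ j, Y j ∈ freeSpectrahedron A (s j))
    (C : (j : Fin k) → Matrix (Fin (s j)) (Fin n) ℝ)
    (hC : (1 - ∑ j, (C j)ᵀ * C j).PosSemidef) :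
    (fun i => ∑ j, (C j)ᵀ * Y j i * C j) ∈ freeSpectrahedron A n := by
  refine ⟨fun i => ?_, ?_⟩
  · rw [Matrix.IsSymm, Matrix.transpose_sum]
    refine Finset.sum_congr rfl fun j _ => ?_
    rw [Matrix.transpose_mul, Matrix.transpose_mul, Matrix.transpose_transpose, (hY j).1 i,
      Matrix.mul_assoc]
  -- The defect `1 - ∑ CᵀC` is the weight of the point `0`, whose pencil is the identity.
  · have key : monicPencil A (fun i => ∑ j, (C j)ᵀ * Y j i * C j) =
        (1 : Matrix (Fin d) (Fin d) ℝ) ⊗ₖ (1 - ∑ j, (C j)ᵀ * C j) +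
        ∑ j, ((1 : Matrix (Fin d) (Fin d) ℝ) ⊗ₖ C j)ᴴ * monicPencil A (Y j) *
          ((1 : Matrix (Fin d) (Fin d) ℝ) ⊗ₖ C j) := by
      have e : ∀ j, ((1 : Matrix (Fin d) (Fin d) ℝ) ⊗ₖ C j)ᴴ * monicPencil A (Y j) *
          ((1 : Matrix (Fin d) (Fin d) ℝ) ⊗ₖ C j) =
          (1 : Matrix (Fin d) (Fin d) ℝ) ⊗ₖ ((C j)ᵀ * C j) +
            ∑ i, A i ⊗ₖ ((C j)ᵀ * Y j i * C j) := by
        intro j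
        rw [monicPencil, Matrix.conjTranspose_kronecker, Matrix.mul_add, Matrix.add_mul,
          Matrix.mul_one, ← Matrix.mul_kronecker_mul, Matrix.mul_sum, Matrix.sum_mul]
        simp [← Matrix.mul_kronecker_mul, Matrix.conjTranspose_eq_transpose_of_trivial]
      have ksum : ∀ (B : Matrix (Fin d) (Fin d) ℝ) (F : Fin k → Matrix (Fin n) (Fin n) ℝ),
          B ⊗ₖ (∑ j, F j) = ∑ j, B ⊗ₖ F j := fun B F =>
        map_sum (Matrix.kroneckerBilinear (R := ℝ) B) F Finset.univ
      have ksub : ∀ (B : Matrix (Fin d) (Fin d) ℝ) (F G : Matrix (Fin n) (Fin n) ℝ),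
          B ⊗ₖ (F - G) = B ⊗ₖ F - B ⊗ₖ G := fun B F G =>
        map_sub (Matrix.kroneckerBilinear (R := ℝ) B) F G
      simp_rw [e, Finset.sum_add_distrib, monicPencil, ksub, ksum]
      rw [Finset.sum_comm, Matrix.one_kronecker_one]
      abel
    rw [key]
    refine (Matrix.PosSemidef.one.kronecker hC).add
      (Matrix.posSemidef_sum _ fun j _ => (hY j).2.conjTranspose_mul_mul_same _)

theorem freeSpectrahedron_compress (A : MatTuple g d) {m : ℕ} {Y : MatTuple g m}
    (hY : Y ∈ freeSpectrahedron A m) (C : Matrix (Fin m) (Fin n) ℝ)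
    (hC : (1 - Cᵀ * C).PosSemidef) :
    (fun i => Cᵀ * Y i * C) ∈ freeSpectrahedron A n := by
  simpa using freeSpectrahedron_sum_compress A (k := 1) (s := fun _ => m) (Y := fun _ => Y)
    (fun _ => hY) (fun _ => C) (by simpa using hC)

/-- A matrix with orthonormal columns can be completed to an orthogonal matrix. -/
theorem exists_orthogonal_completion {N m : ℕ} (hm : n + m = N) (U : Matrix (Fin N) (Fin n) ℝ)
    (hU : Uᵀ * U = 1) :
    ∃ U' : Matrix (Fin N) (Fin m) ℝ, U'ᵀ * U' = 1 ∧ Uᵀ * U' = 0 ∧ U'ᵀ * U = 0 ∧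
      U * Uᵀ + U' * U'ᵀ = 1 := by
  let v : Fin n ⊕ Fin m → EuclideanSpace ℝ (Fin N) :=
    Sum.elim (fun j => WithLp.toLp 2 (fun i => U i j)) 0
  have hv : Orthonormal ℝ ((Set.range Sum.inl).domRestrict v) := by
    rw [orthonormal_iff_ite]
    rintro ⟨_, i, rfl⟩ ⟨_, j, rfl⟩
    have := congrFun (congrFun hU j) i
    simp only [Matrix.mul_apply, Matrix.transpose_apply, Matrix.one_apply] at this
    have e : inner ℝ (v (Sum.inl i)) (v (Sum.inl j)) = if j = i then 1 else 0 := by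
      simpa [v, PiLp.inner_apply] using this
    refine e.trans ?_
    by_cases hij : j = i
    · subst hij
      simp
    · rw [if_neg hij, if_neg]
      intro h
      exact hij (Sum.inl_injective (Subtype.ext_iff.mp h)).symm
  obtain ⟨b, hb⟩ := hv.exists_orthonormalBasis_extension_of_card_eq (by simp [hm])
  have hbU : ∀ j i, b (Sum.inl j) i = U i j := fun j i => by
    rw [hb _ ⟨j, rfl⟩]; rfl
  let W : Matrix (Fin N) (Fin n ⊕ Fin m) ℝ := Matrix.of fun i j => b j i
  have hWW : Wᵀ * W = 1 := by
    ext i j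
    have := orthonormal_iff_ite.mp b.orthonormal j i
    simpa [W, PiLp.inner_apply, Matrix.mul_apply, Matrix.one_apply, eq_comm] using this
  have hWf : W = Matrix.fromCols U (Matrix.of fun i j => b (Sum.inr j) i) := by
    ext i (j | j)
    · simp [W, hbU]
    · simp [W]
  have hWW' : W * Wᵀ = 1 :=
    (Matrix.mul_eq_one_comm_of_card_eq (Fin n ⊕ Fin m) (Fin N) ℝ (by simp [hm])).1 hWW
  rw [hWf] at hWW hWW'
  rw [Matrix.transpose_fromCols, Matrix.fromRows_mul_fromCols, ← Matrix.fromBlocks_one,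
    Matrix.fromBlocks_inj] at hWW
  rw [Matrix.transpose_fromCols, Matrix.fromCols_mul_fromRows] at hWW'
  exact ⟨_, hWW.2.2.2, hWW.2.1, hWW.2.2.1, hWW'⟩

theorem freeSpectrahedron_submatrix (A : MatTuple g d) {m : ℕ} {Y : MatTuple g m}
    (hY : Y ∈ freeSpectrahedron A m) {f : Fin n → Fin m} (hf : f.Injective) :
    (fun i => (Y i).submatrix f f) ∈ freeSpectrahedron A n := by
  refine ⟨fun i => (hY.1 i).submatrix f, ?_⟩
  have : monicPencil A (fun i => (Y i).submatrix f f) =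
      (monicPencil A Y).submatrix (Prod.map id f) (Prod.map id f) := by
    ext ⟨a, p⟩ ⟨b, q⟩
    simp [monicPencil, Matrix.one_apply, Matrix.sum_apply, hf.eq_iff]
  rw [this]
  exact hY.2.submatrix _

theorem trace_blockTuple {m : ℕ} (X : MatTuple g n) (β : Fin g → Matrix (Fin n) (Fin m) ℝ)
    (γ : MatTuple g m) (i : Fin g) :
    (blockTuple X β γ i).trace = (X i).trace + (γ i).trace := by
  have h := Equiv.sum_comp finSumFinEquiv.symm
    (fun q => (Matrix.fromBlocks (X i) (β i) (β i)ᵀ (γ i)) q q)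
  rw [Fintype.sum_sum_type] at h
  exact h

theorem trace_blockTuple_sq {m : ℕ} (X : MatTuple g n) (β : Fin g → Matrix (Fin n) (Fin m) ℝ)
    (γ : MatTuple g m) (i : Fin g) :
    (blockTuple X β γ i * blockTuple X β γ i).trace =
      (X i * X i).trace + 2 * ((β i)ᵀ * β i).trace + (γ i * γ i).trace := by
  have h : blockTuple X β γ i * blockTuple X β γ i =
      Matrix.reindex finSumFinEquiv finSumFinEquiv
        (Matrix.fromBlocks (X i) (β i) (β i)ᵀ (γ i) *
          Matrix.fromBlocks (X i) (β i) (β i)ᵀ (γ i)) := by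
    simp [blockTuple, Matrix.submatrix_mul_equiv]
  have h' : ∀ M : Matrix (Fin n ⊕ Fin m) (Fin n ⊕ Fin m) ℝ,
      (Matrix.reindex finSumFinEquiv finSumFinEquiv M).trace = M.trace := fun M =>
    Equiv.sum_comp finSumFinEquiv.symm (fun q => M q q)
  have h'' : ∀ (M₁ : Matrix (Fin n) (Fin n) ℝ) (M₂ : Matrix (Fin n) (Fin m) ℝ)
      (M₃ : Matrix (Fin m) (Fin n) ℝ) (M₄ : Matrix (Fin m) (Fin m) ℝ),
      (Matrix.fromBlocks M₁ M₂ M₃ M₄).trace = M₁.trace + M₄.trace := fun _ _ _ _ =>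
    Fintype.sum_sum_type _
  rw [h, h', Matrix.fromBlocks_multiply, h'', Matrix.trace_add, Matrix.trace_add, Matrix.trace_mul_comm (β i)]
  ring

/-- A free extreme point is in the Arveson boundary: a one-column dilation which is orthogonally
equivalent to a direct sum is trivial, by comparison of traces. -/
theorem mem_arvesonBoundary_of_mem_freeExtremePoints (A : MatTuple g d) (hn : 0 < n)
    {X : MatTuple g n} (hX : X ∈ freeExtremePoints (freeSpectrahedron A) n) :
    X ∈ arvesonBoundary (freeSpectrahedron A) n := by
  refine ⟨hX.1, fun m β γ hY => ?_⟩
  funext i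
  ext p k
  -- It suffices to treat one column at a time. The complement `Z` below is then `1 × 1`, hence
  -- determined by its trace.
  let β' : Fin g → Matrix (Fin n) (Fin 1) ℝ := fun i => (β i).submatrix id fun _ => k
  let γ' : MatTuple g 1 := fun i => (γ i).submatrix (fun _ => k) fun _ => k
  have hY' : blockTuple X β' γ' ∈ freeSpectrahedron A (n + 1) := by
    have hinj : Function.Injective
        (finSumFinEquiv ∘ Sum.map id (fun _ : Fin 1 => k) ∘ finSumFinEquiv.symm :
          Fin (n + 1) → Fin (n + m)) :=
      finSumFinEquiv.injective.comp ((Function.injective_id.sumMap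
        (Function.injective_of_subsingleton _)).comp finSumFinEquiv.symm.injective)
    convert freeSpectrahedron_submatrix A hY hinj using 1
    funext i
    ext a b
    obtain ⟨a, rfl⟩ := finSumFinEquiv.surjective a
    obtain ⟨b, rfl⟩ := finSumFinEquiv.surjective b
    rcases a with a | a <;> rcases b with b | b <;>
      simp [blockTuple, β', γ', -finSumFinEquiv_apply_left, -finSumFinEquiv_apply_right]
  let V : Matrix (Fin (n + 1)) (Fin n) ℝ :=
    (1 : Matrix (Fin (n + 1)) (Fin (n + 1)) ℝ).submatrix id (Fin.castAdd 1)
  have hVY : ∀ M : Matrix (Fin (n + 1)) (Fin (n + 1)) ℝ,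
      Vᵀ * M * V = M.submatrix (Fin.castAdd 1) (Fin.castAdd 1) := by
    intro M
    ext a b
    simp [V, Matrix.mul_apply, Matrix.one_apply]
  have hVV : Vᵀ * V = 1 := by
    have := hVY 1
    rw [Matrix.mul_one] at this
    rw [this, Matrix.submatrix_one _ (Fin.castAdd_injective n 1)]
  have hV0 : V ≠ 0 := by
    intro h
    have := congrFun (congrFun hVV ⟨0, hn⟩) ⟨0, hn⟩
    simp [h] at this
  have hXV : ∀ i, X i = Vᵀ * blockTuple X β' γ' i * V := by
    intro i
    rw [hVY]
    ext a b
    simp [blockTuple]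
  rcases hX.2 1 (fun _ => n + 1) (fun _ => blockTuple X β' γ') (fun _ => V) (fun _ => hY')
    (fun _ => hV0) (by simpa using hVV) (by simpa using hXV) 0 with h | ⟨_, m', Z, _, U, h1, h2, h3⟩
  · simp at h
  have hm' : m' = 1 := by
    have := Matrix.trace_mul_comm U Uᵀ
    rw [h1, h2] at this
    simp only [Matrix.trace_one, Fintype.card_fin] at this
    have := Nat.cast_injective (R := ℝ) this
    omega
  subst hm'
  have t1 : (blockTuple X β' γ' i).trace = (directSum X Z i).trace := by
    rw [← h3, Matrix.trace_mul_cycle, h2, Matrix.one_mul]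
  have t2 : (blockTuple X β' γ' i * blockTuple X β' γ' i).trace =
      (directSum X Z i * directSum X Z i).trace := by
    have : Uᵀ * directSum X Z i * U * (Uᵀ * directSum X Z i * U) =
        Uᵀ * (directSum X Z i * directSum X Z i) * U := by
      calc _ = Uᵀ * directSum X Z i * (U * Uᵀ) * directSum X Z i * U := by
            simp only [Matrix.mul_assoc]
        _ = _ := by rw [h2]; simp only [Matrix.mul_assoc, Matrix.mul_one]
    rw [← h3, this, Matrix.trace_mul_cycle, h2, Matrix.one_mul]
  rw [directSum, trace_blockTuple, trace_blockTuple] at t1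
  rw [directSum, trace_blockTuple_sq, trace_blockTuple_sq] at t2
  -- Equal traces identify `γ'` with `Z`; equal traces of squares then leave `2 tr(β'ᵀβ') = 0`.
  have hγ : γ' i 0 0 = Z i 0 0 := by simpa [Matrix.trace] using t1
  have hβ : ((β' i)ᵀ * β' i).trace = 0 := by
    simpa [Matrix.trace, Matrix.mul_apply, hγ] using t2
  rw [← Matrix.conjTranspose_eq_transpose_of_trivial,
    Matrix.trace_conjTranspose_mul_self_eq_zero_iff] at hβ
  exact congrFun (congrFun hβ p) 0

/-- A proper reducing subspace and its complement exhibit `X` as a matrix convex combination of two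
compressions of smaller size, which free extremality forbids. -/
theorem isIrreducible_of_mem_freeExtremePoints (A : MatTuple g d)
    {X : MatTuple g n} (hX : X ∈ freeExtremePoints (freeSpectrahedron A) n) :
    IsIrreducible X := by
  intro N hN
  by_contra! hcon
  obtain ⟨hbot, htop⟩ := hcon
  set r := Module.finrank ℝ N with hr
  have hr0 : 0 < r := Nat.pos_of_ne_zero fun h => hbot (Submodule.finrank_eq_zero.mp h)
  have hrn : r < n := by
    simpa using Submodule.finrank_lt htop
  let b : OrthonormalBasis (Fin r) ℝ N := stdOrthonormalBasis ℝ N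
  let U : Matrix (Fin n) (Fin r) ℝ := Matrix.of fun p k => (b k : EuclideanSpace ℝ (Fin n)) p
  have hU : Uᵀ * U = 1 := by
    ext i j
    have := orthonormal_iff_ite.mp b.orthonormal j i
    simpa [U, PiLp.inner_apply, Matrix.mul_apply, Matrix.one_apply, eq_comm] using this
  obtain ⟨U', hU', hUU', hU'U, hsum⟩ :=
    exists_orthogonal_completion (m := n - r) (by omega) U hU
  have hperp : ∀ v : EuclideanSpace ℝ (Fin n), v ∈ N → U'ᵀ *ᵥ v.ofLp = 0 := by
    intro v hv
    have e : v.ofLp = U *ᵥ (b.repr ⟨v, hv⟩).ofLp := by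
      have := congrArg (fun w : N => (w : EuclideanSpace ℝ (Fin n)).ofLp) (b.sum_repr ⟨v, hv⟩)
      funext p
      have := congrFun this p
      simp only [AddSubmonoidClass.coe_finsetSum] at this
      rw [← this]
      simp [U, Matrix.mulVec, dotProduct, mul_comm]
    rw [e, Matrix.mulVec_mulVec, hU'U, Matrix.zero_mulVec]
  have hinv : ∀ i, U'ᵀ * X i * U = 0 := by
    intro i
    ext a k
    have h1 := hperp _ ((hN i).1 (b k) (b k).2)
    have h2 := congrFun h1 a
    simp only [Matrix.ofLp_toLpLin, Matrix.toLin'_apply, Matrix.mulVec_mulVec] at h2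
    exact h2
  have hsymm : ∀ i, Uᵀ * X i * U' = 0 := by
    intro i
    have := congrArg Matrix.transpose (hinv i)
    rwa [Matrix.transpose_mul, Matrix.transpose_mul, Matrix.transpose_transpose, hX.1.1 i,
      Matrix.transpose_zero, ← Matrix.mul_assoc] at this
  have hdec : ∀ i, X i = U * (Uᵀ * X i * U) * Uᵀ + U' * (U'ᵀ * X i * U') * U'ᵀ := by
    intro i
    calc X i = (U * Uᵀ + U' * U'ᵀ) * X i * (U * Uᵀ + U' * U'ᵀ) := by
          rw [hsum, Matrix.one_mul, Matrix.mul_one]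
      _ = U * (Uᵀ * X i * U) * Uᵀ + U' * (U'ᵀ * X i * U') * U'ᵀ
          + (U * (Uᵀ * X i * U') * U'ᵀ + U' * (U'ᵀ * X i * U) * Uᵀ) := by
          simp only [Matrix.mul_add, Matrix.add_mul, Matrix.mul_assoc]
          abel
      _ = _ := by simp [hinv, hsymm]
  have hne : ∀ {m : ℕ} (W : Matrix (Fin n) (Fin m) ℝ), 0 < m → Wᵀ * W = 1 → Wᵀ ≠ 0 := by
    intro m W hm hW h
    have := congrFun (congrFun hW ⟨0, hm⟩) ⟨0, hm⟩
    simp [h] at this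
  let s : Fin 2 → ℕ := ![r, n - r]
  let Y : (j : Fin 2) → MatTuple g (s j) := fun j => match j with
    | 0 => fun i => Uᵀ * X i * U
    | 1 => fun i => U'ᵀ * X i * U'
  let V : (j : Fin 2) → Matrix (Fin (s j)) (Fin n) ℝ := fun j => match j with
    | 0 => Uᵀ
    | 1 => U'ᵀ
  have hcomp : ∀ {m : ℕ} (W : Matrix (Fin n) (Fin m) ℝ), Wᵀ * W = 1 →
      (fun i => Wᵀ * X i * W) ∈ freeSpectrahedron A m := fun W hW =>
    freeSpectrahedron_compress A hX.1 W (by rw [hW, sub_self]; exact .zero)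
  have h := hX.2 2 s Y V (Fin.forall_fin_two.mpr ⟨hcomp U hU, hcomp U' hU'⟩)
    (Fin.forall_fin_two.mpr ⟨hne U hr0 hU, hne U' (by omega) hU'⟩)
    (by rw [Fin.sum_univ_two]; exact hsum)
    (fun i => by rw [Fin.sum_univ_two]; exact hdec i) 0
  have hs : s 0 = r := rfl
  rcases h with h | h
  · omega
  · omega

/-- Schur's lemma for symmetric matrices commuting with an irreducible symmetric tuple. -/
theorem IsIrreducible.exists_eq_smul_one {X : MatTuple g n} (hirr : IsIrreducible X)
    (hX : ∀ i, (X i).IsSymm) (hn : 0 < n) {M : Matrix (Fin n) (Fin n) ℝ} (hM : M.IsSymm)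
    (hMX : ∀ i, M * X i = X i * M) : ∃ t : ℝ, M = t • 1 := by
  have hH : M.IsHermitian := by
    rw [Matrix.IsHermitian, Matrix.conjTranspose_eq_transpose_of_trivial]; exact hM
  let k : Fin n := ⟨0, hn⟩
  refine ⟨hH.eigenvalues k, ?_⟩
  set t := hH.eigenvalues k
  -- An eigenspace of `M` is nonzero and reducing, hence everything.
  let N : Submodule ℝ (EuclideanSpace ℝ (Fin n)) :=
    LinearMap.ker (Matrix.toEuclideanLin (M - t • 1))
  have hN : ∀ v : EuclideanSpace ℝ (Fin n), v ∈ N ↔ (M - t • 1) *ᵥ v.ofLp = 0 := by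
    intro v
    rw [LinearMap.mem_ker, ← (WithLp.ofLp_injective 2).eq_iff, Matrix.ofLp_toLpLin,
      Matrix.toLin'_apply]
    rfl
  have hcomm : ∀ i, (M - t • 1) * X i = X i * (M - t • 1) := fun i => by
    rw [Matrix.sub_mul, Matrix.mul_sub, hMX]; simp
  have hinv : ∀ i, ∀ v ∈ N, Matrix.toEuclideanLin (X i) v ∈ N := by
    intro i v hv
    rw [hN] at hv ⊢
    rw [Matrix.ofLp_toLpLin, Matrix.toLin'_apply, Matrix.mulVec_mulVec, hcomm,
      ← Matrix.mulVec_mulVec, hv, Matrix.mulVec_zero]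
  have hred : ∀ i, IsReducing (X i) N := by
    refine fun i => ⟨hinv i, fun v hv => ?_⟩
    rw [Submodule.mem_orthogonal] at hv ⊢
    intro w hw
    have hs : (Matrix.toEuclideanLin (X i)).IsSymmetric := by
      rw [Matrix.isSymmetric_toEuclideanLin_iff, Matrix.IsHermitian,
        Matrix.conjTranspose_eq_transpose_of_trivial]
      exact hX i
    rw [← hs w v]
    exact hv _ (hinv i w hw)
  rcases hirr N hred with h | h
  · exfalso
    have hmem : hH.eigenvectorBasis k ∈ N := by
      rw [hN, Matrix.sub_mulVec, hH.mulVec_eigenvectorBasis]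
      simp [t, Matrix.smul_mulVec]
    rw [h, Submodule.mem_bot] at hmem
    have := hH.eigenvectorBasis.orthonormal.ne_zero k
    exact this hmem
  · rw [← sub_eq_zero]
    refine Matrix.ext_of_mulVec_single fun j => ?_
    have : (WithLp.toLp 2 (Pi.single j 1) : EuclideanSpace ℝ (Fin n)) ∈ N := h ▸ Submodule.mem_top
    rw [hN] at this
    rw [Matrix.zero_mulVec]
    exact this

/-- If a point of the Arveson boundary is a matrix convex combination of points of the free
spectrahedron, then the coefficient matrices intertwine. -/
theorem intertwines_of_mem_arvesonBoundary (A : MatTuple g d) {X : MatTuple g n}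
    (hX : X ∈ arvesonBoundary (freeSpectrahedron A) n) {k : ℕ} {s : Fin k → ℕ}
    {Y : (j : Fin k) → MatTuple g (s j)} (hY : ∀ j, Y j ∈ freeSpectrahedron A (s j))
    (V : (j : Fin k) → Matrix (Fin (s j)) (Fin n) ℝ) (hV : ∑ j, (V j)ᵀ * V j = 1)
    (hXV : ∀ i, X i = ∑ j, (V j)ᵀ * Y j i * V j) (l : Fin k) (i : Fin g) :
    (V l)ᵀ * Y l i = X i * (V l)ᵀ := by
  classical
  -- The inclusion of the `l`-th summand into the direct sum of all `Y j`; comparing sigma pairs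
  -- avoids a cast between `Fin (s j)` and `Fin (s l)`.
  let J : (j : Fin k) → Matrix (Fin (s j)) (Fin (s l)) ℝ := fun j => Matrix.of fun p q =>
    if (⟨j, p⟩ : Σ j, Fin (s j)) = ⟨l, q⟩ then 1 else 0
  have hJl : J l = 1 := by
    ext p q
    simp [J, Matrix.one_apply]
  have hJ : ∀ j, j ≠ l → J j = 0 := by
    intro j hj
    ext p q
    simp [J, hj]
  have hsumJ : ∀ {r : ℕ} (F : (j : Fin k) → Matrix (Fin r) (Fin (s j)) ℝ),
      ∑ j, F j * J j = F l := by
    intro r F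
    rw [Finset.sum_eq_single l (fun j _ hj => by rw [hJ j hj, Matrix.mul_zero])
      (fun h => absurd (Finset.mem_univ l) h), hJl, Matrix.mul_one]
  -- Stacking the `V j` gives an isometry `V`, and `E = (1 - V Vᵀ) J`. Then `VᵀE = 0` and `EᵀE ≤ 1`,
  -- so `C = (V E)` is a contraction. Compressing `⊕ Y j` by it dilates `X` with off-diagonal block
  -- `(V l)ᵀ Y l - X (V l)ᵀ`.
  let E : (j : Fin k) → Matrix (Fin (s j)) (Fin (s l)) ℝ := fun j => J j - V j * (V l)ᵀ
  have hVE : ∑ j, (V j)ᵀ * E j = 0 := by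
    simp_rw [E, Matrix.mul_sub, Finset.sum_sub_distrib, hsumJ, ← Matrix.mul_assoc,
      ← Matrix.sum_mul, hV, Matrix.one_mul, sub_self]
  have hEV : ∑ j, (E j)ᵀ * V j = 0 := by
    have := congrArg Matrix.transpose hVE
    simpa [Matrix.transpose_sum] using this
  have hEE : ∑ j, (E j)ᵀ * E j = 1 - V l * (V l)ᵀ := by
    have e : ∀ j, (E j)ᵀ * E j = (E j)ᵀ * J j - (E j)ᵀ * V j * (V l)ᵀ := fun j => by
      rw [Matrix.mul_assoc, ← Matrix.mul_sub]
    simp_rw [e, Finset.sum_sub_distrib, hsumJ, ← Matrix.sum_mul, hEV, Matrix.zero_mul, sub_zero]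
    simp [E, hJl]
  let C : (j : Fin k) → Matrix (Fin (s j)) (Fin (n + s l)) ℝ := fun j =>
    (Matrix.fromCols (V j) (E j)).submatrix id finSumFinEquiv.symm
  have hC : ∀ M : (j : Fin k) → Matrix (Fin (s j)) (Fin (s j)) ℝ,
      ∑ j, (C j)ᵀ * M j * C j = Matrix.reindex finSumFinEquiv finSumFinEquiv
        (Matrix.fromBlocks (∑ j, (V j)ᵀ * M j * V j) (∑ j, (V j)ᵀ * M j * E j)
          (∑ j, (E j)ᵀ * M j * V j) (∑ j, (E j)ᵀ * M j * E j)) := by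
    intro M
    have e : ∀ j, (C j)ᵀ * M j * C j = ((Matrix.fromBlocks ((V j)ᵀ * M j * V j)
        ((V j)ᵀ * M j * E j) ((E j)ᵀ * M j * V j) ((E j)ᵀ * M j * E j))).submatrix
          finSumFinEquiv.symm finSumFinEquiv.symm := by
      intro j
      rw [← Matrix.fromRows_mul_fromCols, ← Matrix.fromRows_mul, ← Matrix.transpose_fromCols]
      rfl
    ext a b
    obtain ⟨a, rfl⟩ := finSumFinEquiv.surjective a
    obtain ⟨b, rfl⟩ := finSumFinEquiv.surjective b
    simp_rw [e, Matrix.sum_apply, Matrix.reindex_apply, Matrix.submatrix_apply,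
      Equiv.symm_apply_apply]
    rcases a with a | a <;> rcases b with b | b <;> simp [Matrix.sum_apply]
  have hCC : (1 - ∑ j, (C j)ᵀ * C j).PosSemidef := by
    have h1 := hC fun _ => 1
    simp only [Matrix.mul_one] at h1
    rw [h1, hV, hVE, hEV, hEE]
    have h2 : (1 : Matrix (Fin (n + s l)) (Fin (n + s l)) ℝ) =
        Matrix.reindex finSumFinEquiv finSumFinEquiv (Matrix.fromBlocks 1 0 0 1) := by
      rw [Matrix.fromBlocks_one]; simp
    have h3 : (1 : Matrix (Fin (n + s l)) (Fin (n + s l)) ℝ) -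
        Matrix.reindex finSumFinEquiv finSumFinEquiv
          (Matrix.fromBlocks 1 0 0 (1 - V l * (V l)ᵀ)) =
        ((Matrix.fromRows (0 : Matrix (Fin n) (Fin n) ℝ) (V l)) *
          (Matrix.fromRows (0 : Matrix (Fin n) (Fin n) ℝ) (V l))ᴴ).submatrix
          finSumFinEquiv.symm finSumFinEquiv.symm := by
      rw [h2, Matrix.conjTranspose_eq_transpose_of_trivial, Matrix.transpose_fromRows,
        Matrix.fromRows_mul_fromCols]
      ext a b
      obtain ⟨a, rfl⟩ := finSumFinEquiv.surjective a
      obtain ⟨b, rfl⟩ := finSumFinEquiv.surjective b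
      simp_rw [Matrix.sub_apply, Matrix.reindex_apply, Matrix.submatrix_apply,
        Equiv.symm_apply_apply]
      rcases a with a | a <;> rcases b with b | b <;> simp
    rw [h3]
    exact (Matrix.posSemidef_self_mul_conjTranspose _).submatrix _
  have hmem := freeSpectrahedron_sum_compress A hY C hCC
  have hsym : ∀ i, ∑ j, (E j)ᵀ * Y j i * V j = (∑ j, (V j)ᵀ * Y j i * E j)ᵀ := by
    intro i
    rw [Matrix.transpose_sum]
    refine Finset.sum_congr rfl fun j _ => ?_
    rw [Matrix.transpose_mul, Matrix.transpose_mul, Matrix.transpose_transpose, (hY j).1 i,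
      Matrix.mul_assoc]
  have hblock : (fun i => ∑ j, (C j)ᵀ * Y j i * C j) =
      blockTuple X (fun i => ∑ j, (V j)ᵀ * Y j i * E j) (fun i => ∑ j, (E j)ᵀ * Y j i * E j) := by
    funext i
    rw [hC fun j => Y j i, hsym, ← hXV, blockTuple]
  rw [hblock] at hmem
  have hzero := congrFun (hX.2 _ _ _ hmem) i
  simp_rw [E, Matrix.mul_sub, Finset.sum_sub_distrib, hsumJ, ← Matrix.mul_assoc,
    ← Matrix.sum_mul, ← hXV] at hzero
  exact sub_eq_zero.mp hzero

/-- Intertwining makes `(V j)ᵀ V j` commute with `X`, so it is scalar by Schur. A multiple of `V j`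
is then an isometry with range reducing for `Y j`, and in an adapted basis `Y j` is `X ⊕ Z`. -/
theorem mem_freeExtremePoints_of_mem_arvesonBoundary (A : MatTuple g d) (hn : 0 < n)
    {X : MatTuple g n} (hX : X ∈ arvesonBoundary (freeSpectrahedron A) n)
    (hirr : IsIrreducible X) : X ∈ freeExtremePoints (freeSpectrahedron A) n := by
  refine ⟨hX.1, fun k s Y V hY hV0 hV hXV j => ?_⟩
  have hint := intertwines_of_mem_arvesonBoundary A hX hY V hV hXV j
  have hint' : ∀ i, Y j i * V j = V j * X i := by
    intro i
    have := congrArg Matrix.transpose (hint i)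
    rwa [Matrix.transpose_mul, Matrix.transpose_mul, Matrix.transpose_transpose, hX.1.1 i,
      (hY j).1 i] at this
  obtain ⟨t, ht⟩ := hirr.exists_eq_smul_one hX.1.1 hn (M := (V j)ᵀ * V j)
    (by rw [Matrix.IsSymm, Matrix.transpose_mul, Matrix.transpose_transpose])
    (fun i => by rw [Matrix.mul_assoc, ← hint', ← Matrix.mul_assoc, hint, Matrix.mul_assoc])
  have ht0 : 0 < t := by
    have hpsd := Matrix.posSemidef_conjTranspose_mul_self (V j)
    rw [Matrix.conjTranspose_eq_transpose_of_trivial, ht] at hpsd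
    have h0 : 0 ≤ t := by simpa using hpsd.diag_nonneg (i := (⟨0, hn⟩ : Fin n))
    refine h0.lt_of_ne fun h => hV0 j ?_
    rw [← h, zero_smul, ← Matrix.conjTranspose_eq_transpose_of_trivial] at ht
    exact Matrix.conjTranspose_mul_self_eq_zero.mp ht
  let U : Matrix (Fin (s j)) (Fin n) ℝ := (√t)⁻¹ • V j
  have hU : Uᵀ * U = 1 := by
    simp only [U, Matrix.transpose_smul, Matrix.smul_mul, Matrix.mul_smul, ht, smul_smul]
    rw [show (√t)⁻¹ * ((√t)⁻¹ * t) = 1 by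
      rw [← mul_assoc, ← mul_inv, Real.mul_self_sqrt ht0.le, inv_mul_cancel₀ ht0.ne'], one_smul]
  have hYU : ∀ i, Y j i * U = U * X i := fun i => by
    simp [U, hint']
  have hUY : ∀ i, Uᵀ * Y j i = X i * Uᵀ := fun i => by
    simp [U, hint]
  have hle : n ≤ s j := by
    have h1 := Matrix.rank_mul_le_right Uᵀ U
    rw [hU, Matrix.rank_one, Fintype.card_fin] at h1
    exact h1.trans (by simpa using U.rank_le_card_height)
  obtain ⟨m, hm⟩ := Nat.exists_eq_add_of_le hle
  obtain ⟨U', h1, h2, h3, h4⟩ := exists_orthogonal_completion hm.symm U hU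
  rcases Nat.eq_zero_or_pos m with rfl | hm0
  · left
    refine ⟨hm, Uᵀ, ?_, ?_, fun i => ?_⟩
    · have : U' * U'ᵀ = 0 := by
        ext a b
        simp [Matrix.mul_apply]
      rw [Matrix.transpose_transpose]
      rwa [this, add_zero] at h4
    · rw [Matrix.transpose_transpose, hU]
    · have : U' * U'ᵀ = 0 := by
        ext a b
        simp [Matrix.mul_apply]
      rw [this, add_zero] at h4
      rw [Matrix.transpose_transpose, ← hYU, Matrix.mul_assoc, h4, Matrix.mul_one]
  · right
    let Z : MatTuple g m := fun i => U'ᵀ * Y j i * U'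
    refine ⟨by omega, m, Z, freeSpectrahedron_compress A (hY j) U'
      (by rw [h1, sub_self]; exact .zero), ?_⟩
    let W : Matrix (Fin (n + m)) (Fin (s j)) ℝ :=
      (Matrix.fromRows Uᵀ U'ᵀ).submatrix finSumFinEquiv.symm id
    have hW : Wᵀ = (Matrix.fromCols U U').submatrix id finSumFinEquiv.symm := by
      rw [Matrix.transpose_submatrix, Matrix.transpose_fromRows, Matrix.transpose_transpose,
        Matrix.transpose_transpose]
    have hYdec : ∀ i, U * X i * Uᵀ + U' * Z i * U'ᵀ = Y j i := by
      intro i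
      have e1 : U * X i * Uᵀ = U * Uᵀ * Y j i := by
        rw [Matrix.mul_assoc, ← hUY, Matrix.mul_assoc]
      have e2 : U' * Z i = Y j i * U' := by
        calc U' * Z i = (U * Uᵀ + U' * U'ᵀ) * (Y j i * U') - U * (Uᵀ * Y j i * U') := by
              simp only [Z, Matrix.add_mul, Matrix.mul_assoc]; abel
          _ = _ := by rw [h4, hUY, Matrix.mul_assoc (X i), h2]; simp
      have e3 : U * Uᵀ * Y j i = Y j i * (U * Uᵀ) := by
        rw [Matrix.mul_assoc, hUY, ← Matrix.mul_assoc, ← Matrix.mul_assoc, hYU]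
      rw [e1, e2, e3, Matrix.mul_assoc, ← Matrix.mul_add, h4, Matrix.mul_one]
    refine ⟨W, ?_, ?_, fun i => ?_⟩
    · rw [hW]
      simp only [W]
      rw [Matrix.submatrix_mul_equiv, Matrix.fromCols_mul_fromRows, h4,
        Matrix.submatrix_id_id]
    · rw [hW]
      change (Matrix.fromRows Uᵀ U'ᵀ * Matrix.fromCols U U').submatrix finSumFinEquiv.symm
        finSumFinEquiv.symm = 1
      rw [Matrix.fromRows_mul_fromCols, hU, h1, h2, h3, Matrix.fromBlocks_one,
        Matrix.submatrix_one_equiv]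
    · rw [hW, directSum, blockTuple, Matrix.reindex_apply]
      simp only [W]
      rw [Matrix.submatrix_mul_equiv, Matrix.submatrix_mul_equiv, Matrix.fromCols_mul_fromBlocks,
        Matrix.fromCols_mul_fromRows]
      simpa using hYdec i

theorem mem_freeExtremePoints_iff (A : MatTuple g d) (hn : 0 < n) (X : MatTuple g n) :
    X ∈ freeExtremePoints (freeSpectrahedron A) n ↔
      X ∈ arvesonBoundary (freeSpectrahedron A) n ∧ IsIrreducible X :=
  ⟨fun h => ⟨mem_arvesonBoundary_of_mem_freeExtremePoints A hn h,
    isIrreducible_of_mem_freeExtremePoints A h⟩,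
    fun h => mem_freeExtremePoints_of_mem_arvesonBoundary A hn h.1 h.2⟩

end MatrixConvexity

/-! ### The algebra of two idempotents. -/

/-- Two idempotents `M`, `N` and the inverse `S` of an affine combination `G` of them: the
discriminant `G * (1 - G)` commutes with both, whence a relation of degree two in `S`. -/
theorem idempotent_pair_identity {R : Type*} [Ring R] [Algebra ℝ R] {M N G S : R} {a b c : ℝ}
    (hM : M * M = M) (hN : N * N = N) (habc : a + b + 2 * c = 1)
    (hG : G = a • M + b • N + c • 1) (hGS : G * S = 1) (hSG : S * G = 1)
    (hunit : IsUnit (1 - G)) :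
    M * S * ((c * (a + c)) • 1 + b • N) * S * (1 - M) = 0 := by
  obtain rfl : c = (1 - a - b) / 2 := by linarith
  set c := (1 - a - b) / 2 with hc
  have hM' : ∀ x, M * (M * x) = M * x := fun x => by rw [← mul_assoc, hM]
  have hN' : ∀ x, N * (N * x) = N * x := fun x => by rw [← mul_assoc, hN]
  set D := G * (1 - G) with hD
  -- With the involutions `P = 2M - 1` and `Q = 2N - 1`, the relation `a + b + 2c = 1` gives `2G = 1
  -- + aP + bQ`. So `4D = 1 - (aP + bQ)²` involves only `PQ + QP`, which commutes with both.
  have hDM : Commute D M := by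
    change D * M = M * D
    rw [hD, hG]
    simp only [mul_add, add_mul, mul_sub, sub_mul, smul_mul_assoc, mul_smul_comm, mul_one,
      one_mul, mul_assoc, hM, hN, hM', smul_add, smul_smul]
    rw [hc]
    module
  have hDN : Commute D N := by
    change D * N = N * D
    rw [hD, hG]
    simp only [mul_add, add_mul, mul_sub, sub_mul, smul_mul_assoc, mul_smul_comm, mul_one,
      one_mul, mul_assoc, hM, hN, hN', smul_add, smul_smul]
    rw [hc]
    module
  have hDS' : D * S = 1 - G := by
    rw [hD, mul_sub, mul_one, sub_mul, mul_assoc, hGS, mul_one]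
  have hSD : S * D = 1 - G := by
    rw [hD, ← mul_assoc, hSG, one_mul]
  -- The product is `M f(N) (1 - M)` for a cubic `f`. As `N` is idempotent and `M (1 - M) = 0`, only
  -- `f(1) - f(0)` matters. With `κ = c(a + c)`, `f(0) = κ(b + c)(a + b + c)` and `f(1) = c(a + c)(κ
  -- + b)` agree; this dictates `κ`.
  have hzero : M * (1 - G) * ((c * (a + c)) • 1 + b • N) * (1 - G) * (1 - M) = 0 := by
    rw [hG]
    simp only [mul_add, add_mul, mul_sub, sub_mul, smul_mul_assoc, mul_smul_comm, mul_one,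
      mul_assoc, hM, hN, smul_add, smul_sub, smul_smul]
    rw [hc]
    module
  set K : R := (c * (a + c)) • 1 + b • N with hK
  have hDK : Commute D K :=
    ((Commute.one_right D).smul_right _).add_right (hDN.smul_right _)
  have hGu : IsUnit G := ⟨⟨G, S, hGS, hSG⟩, rfl⟩
  have hDu : IsUnit D := hGu.mul hunit
  -- Since `D S = 1 - G`, the unit `D²` turns both factors `S` into `1 - G`.
  refine (hDu.mul hDu).mul_left_cancel ?_
  rw [mul_zero, ← hzero]
  calc D * D * (M * S * K * S * (1 - M)) = (D * D * M) * S * K * S * (1 - M) := by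
        simp only [mul_assoc]
    _ = M * D * (D * S) * K * S * (1 - M) := by
        rw [(hDM.mul_left hDM).eq]; simp only [mul_assoc]
    _ = M * (D * S) * (D * K) * S * (1 - M) := by
        have : D * (D * S) = (D * S) * D := by rw [hDS', ← hSD, ← mul_assoc, hSD, hDS']
        rw [mul_assoc M, this]; simp only [mul_assoc]
    _ = M * (D * S) * K * (D * S) * (1 - M) := by rw [hDK.eq]; simp only [mul_assoc]
    _ = _ := by rw [hDS']

/-! ### Complementarity and the cubic relation for positive semidefinite matrices. -/

section Positivity

variable {n : ℕ} {L : Fin 4 → Matrix (Fin n) (Fin n) ℝ} {a b c : ℝ}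

/-- If the form of `S` vanished at `x`, so would those of all `L j`, and hence that of their
combination `1`. -/
theorem quadratic_forms_add (hL : ∀ i, (L i).PosSemidef) (hrel : L 0 + L 2 = L 1 + L 3)
    (hone : a • L 0 + b • L 1 + c • (L 0 + L 2) = 1) {x : Fin n → ℝ} (hx : x ≠ 0) :
    (∀ i, 0 ≤ star x ⬝ᵥ L i *ᵥ x) ∧
    star x ⬝ᵥ L 0 *ᵥ x + star x ⬝ᵥ L 2 *ᵥ x = star x ⬝ᵥ L 1 *ᵥ x + star x ⬝ᵥ L 3 *ᵥ x ∧
    0 < star x ⬝ᵥ L 0 *ᵥ x + star x ⬝ᵥ L 2 *ᵥ x := by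
  have h1 : ∀ i, 0 ≤ star x ⬝ᵥ L i *ᵥ x := fun i => (hL i).dotProduct_mulVec_nonneg x
  have h2 : star x ⬝ᵥ L 0 *ᵥ x + star x ⬝ᵥ L 2 *ᵥ x =
      star x ⬝ᵥ L 1 *ᵥ x + star x ⬝ᵥ L 3 *ᵥ x := by
    simp_rw [← dotProduct_add, ← Matrix.add_mulVec, hrel]
  refine ⟨h1, h2, ?_⟩
  have h3 : 0 < star x ⬝ᵥ (1 : Matrix (Fin n) (Fin n) ℝ) *ᵥ x :=
    Matrix.PosDef.one.dotProduct_mulVec_pos hx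
  rw [← hone] at h3
  simp only [Matrix.add_mulVec, Matrix.smul_mulVec, dotProduct_add, dotProduct_smul,
    smul_eq_mul] at h3
  by_contra hneg
  have h00 := h1 0
  have h11 := h1 1
  have h22 := h1 2
  have h33 := h1 3
  have e0 : star x ⬝ᵥ L 0 *ᵥ x = 0 := by linarith
  have e1 : star x ⬝ᵥ L 1 *ᵥ x = 0 := by linarith
  have e2 : star x ⬝ᵥ L 2 *ᵥ x = 0 := by linarith
  rw [e0, e1, e2] at h3
  simp at h3

theorem posDef_smul_add_smul (hL : ∀ i, (L i).PosSemidef) (hrel : L 0 + L 2 = L 1 + L 3)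
    (hone : a • L 0 + b • L 1 + c • (L 0 + L 2) = 1) {κ ρ : ℝ} (hκ : 0 < κ) (hρ : 0 < ρ) :
    (κ • L 3 + ρ • L 1).PosDef := by
  refine .of_dotProduct_mulVec_pos
    ((((hL 3).smul hκ.le).add ((hL 1).smul hρ.le)).isHermitian) fun x hx => ?_
  obtain ⟨h1, h2, h3⟩ := quadratic_forms_add hL hrel hone hx
  simp only [Matrix.add_mulVec, Matrix.smul_mulVec, dotProduct_add, dotProduct_smul, smul_eq_mul]
  rcases (h1 1).eq_or_lt with h | h
  · rw [← h]
    have := mul_pos hκ (show 0 < star x ⬝ᵥ L 3 *ᵥ x by linarith)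
    linarith
  · have := mul_pos hρ h
    have := mul_nonneg hκ.le (h1 3)
    linarith

theorem posDef_add_zero_two (hL : ∀ i, (L i).PosSemidef) (hrel : L 0 + L 2 = L 1 + L 3)
    (hone : a • L 0 + b • L 1 + c • (L 0 + L 2) = 1) : (L 0 + L 2).PosDef := by
  have := posDef_smul_add_smul hL hrel hone one_pos one_pos
  rwa [one_smul, one_smul, add_comm, ← hrel] at this

/-- When `a + b + 2c = 1` this matrix is `S - 1`. The forms of `L 2` and `L 3` lie between `0` and
that of `S`, so the minimum is at a corner, where the factor is `c`, `a + c`, `b + c` or `a + b +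
c`. -/
theorem posDef_complementary_combination (hL : ∀ i, (L i).PosSemidef)
    (hrel : L 0 + L 2 = L 1 + L 3) (hone : a • L 0 + b • L 1 + c • (L 0 + L 2) = 1)
    (hc : 0 < c) (hac : 0 < a + c) (hbc : 0 < b + c) (habc : 0 < a + b + c) :
    (a • L 2 + b • L 3 + c • (L 0 + L 2)).PosDef := by
  refine .of_dotProduct_mulVec_pos ?_ fun x hx => ?_
  · have h := fun i => (hL i).isHermitian
    simp only [Matrix.IsHermitian, Matrix.conjTranspose_add, Matrix.conjTranspose_smul,
      star_trivial] at h ⊢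
    simp only [h]
  obtain ⟨h1, h2, h3⟩ := quadratic_forms_add hL hrel hone hx
  simp only [Matrix.add_mulVec, Matrix.smul_mulVec, dotProduct_add, dotProduct_smul, smul_eq_mul]
  have h00 := h1 0
  have h11 := h1 1
  have h22 := h1 2
  have h33 := h1 3
  generalize star x ⬝ᵥ L 0 *ᵥ x = q0 at *
  generalize star x ⬝ᵥ L 1 *ᵥ x = q1 at *
  generalize star x ⬝ᵥ L 2 *ᵥ x = q2 at *
  generalize star x ⬝ᵥ L 3 *ᵥ x = q3 at *
  have pc := mul_pos hc h3
  have pac := mul_pos hac h3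
  have pbc := mul_pos hbc h3
  have pabc := mul_pos habc h3
  have ha : min a 0 * (q0 + q2) ≤ a * q2 := by
    rcases le_total a 0 with h | h
    · rw [min_eq_left h]; nlinarith
    · rw [min_eq_right h]; nlinarith
  have hb : min b 0 * (q0 + q2) ≤ b * q3 := by
    rcases le_total b 0 with h | h
    · rw [min_eq_left h]; nlinarith
    · rw [min_eq_right h]; nlinarith
  rcases le_total a 0 with h | h <;> rcases le_total b 0 with h' | h' <;>
    simp only [h, h', min_eq_left, min_eq_right] at ha hb <;> nlinarith

/-- The relation satisfied when the opposite pairs are complementary. -/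
theorem mul_mul_eq_zero_of_complementary (hL : ∀ i, (L i).PosSemidef)
    (hrel : L 0 + L 2 = L 1 + L 3) (hone : a • L 0 + b • L 1 + c • (L 0 + L 2) = 1)
    (hsum : a + b + 2 * c = 1)
    (hc : 0 < c) (hac : 0 < a + c) (hbc : 0 < b + c) (habc : 0 < a + b + c)
    (h02 : L 0 * (L 0 + L 2)⁻¹ * L 2 = 0) (h13 : L 1 * (L 0 + L 2)⁻¹ * L 3 = 0) :
    L 0 * ((c * (a + c)) • L 3 + (c * (a + c) + b) • L 1) * L 2 = 0 := by
  have hSpd := posDef_add_zero_two hL hrel hone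
  set S := L 0 + L 2 with hS
  have hdet : IsUnit S.det := (Matrix.isUnit_iff_isUnit_det _).mp hSpd.isUnit
  have hGS : S⁻¹ * S = 1 := Matrix.nonsing_inv_mul _ hdet
  have hSG : S * S⁻¹ = 1 := Matrix.mul_nonsing_inv _ hdet
  have hL2 : L 2 = S - L 0 := by rw [hS]; abel
  have hL3 : L 3 = S - L 1 := by rw [hrel]; abel
  -- Given `L 2 = S - L 0`, complementarity says that `S⁻¹ L 0` is idempotent.
  have hM : S⁻¹ * L 0 * (S⁻¹ * L 0) = S⁻¹ * L 0 := by
    have h := h02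
    rw [hL2, Matrix.mul_sub, Matrix.mul_assoc, hGS, Matrix.mul_one, sub_eq_zero] at h
    calc _ = S⁻¹ * (L 0 * S⁻¹ * L 0) := by simp only [Matrix.mul_assoc]
      _ = _ := by rw [← h]
  have hN : S⁻¹ * L 1 * (S⁻¹ * L 1) = S⁻¹ * L 1 := by
    have h := h13
    rw [hL3, Matrix.mul_sub, Matrix.mul_assoc, hGS, Matrix.mul_one, sub_eq_zero] at h
    calc _ = S⁻¹ * (L 1 * S⁻¹ * L 1) := by simp only [Matrix.mul_assoc]
      _ = _ := by rw [← h]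
  have hG : S⁻¹ = a • (S⁻¹ * L 0) + b • (S⁻¹ * L 1) + c • 1 := by
    calc S⁻¹ = S⁻¹ * (a • L 0 + b • L 1 + c • S) := by rw [hone, Matrix.mul_one]
      _ = _ := by rw [Matrix.mul_add, Matrix.mul_add, Matrix.mul_smul, Matrix.mul_smul,
                    Matrix.mul_smul, hGS]
  have hU : a • L 2 + b • L 3 + c • S = S - 1 := by
    rw [← hone, hL2, hL3]
    rw [show a = 1 - b - 2 * c by linarith]
    module
  have hunit : IsUnit (1 - S⁻¹) := by
    have h := (posDef_complementary_combination hL hrel hone hc hac hbc habc).isUnit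
    rw [← hS, hU] at h
    have h' : IsUnit S⁻¹ := hSpd.inv.isUnit
    have := h'.mul h
    rwa [Matrix.mul_sub, hGS, Matrix.mul_one] at this
  have key := idempotent_pair_identity hM hN hsum hG hGS hSG hunit
  have hL0' : S * (S⁻¹ * L 0) = L 0 := by rw [← Matrix.mul_assoc, hSG, Matrix.one_mul]
  have hW : (c * (a + c)) • L 3 + (c * (a + c) + b) • L 1 =
      S * ((c * (a + c)) • 1 + b • (S⁻¹ * L 1)) := by
    rw [Matrix.mul_add, Matrix.mul_smul, Matrix.mul_smul, Matrix.mul_one, ← Matrix.mul_assoc, hSG,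
      Matrix.one_mul, hL3]
    module
  have hL2' : L 2 = S * (1 - S⁻¹ * L 0) := by
    rw [Matrix.mul_sub, hL0', Matrix.mul_one, hL2]
  calc L 0 * ((c * (a + c)) • L 3 + (c * (a + c) + b) • L 1) * L 2 =
      S * (S⁻¹ * L 0) * (S * ((c * (a + c)) • 1 + b • (S⁻¹ * L 1))) *
        (S * (1 - S⁻¹ * L 0)) := by rw [hW, hL0', ← hL2']
    _ = S * (S⁻¹ * L 0 * S * ((c * (a + c)) • 1 + b • (S⁻¹ * L 1)) * S * (1 - S⁻¹ * L 0)) := by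
      simp only [Matrix.mul_assoc]
    _ = 0 := by rw [key, Matrix.mul_zero]

/-- `R = L 0 S⁻¹ L 2` is symmetric because `L 2 = S - L 0`. Hence `R W R = L 2 S⁻¹ (L 0 W L 2) S⁻¹ L
0 = 0` with `W` positive definite, which forces `R = 0`. -/
theorem complementary_of_mul_mul_eq_zero (hL : ∀ i, (L i).PosSemidef)
    (hrel : L 0 + L 2 = L 1 + L 3) (hone : a • L 0 + b • L 1 + c • (L 0 + L 2) = 1)
    {κ ρ : ℝ} (hκ : 0 < κ) (hρ : 0 < ρ) (h : L 0 * (κ • L 3 + ρ • L 1) * L 2 = 0) :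
    L 0 * (L 0 + L 2)⁻¹ * L 2 = 0 := by
  have hSpd := posDef_add_zero_two hL hrel hone
  have hWpd := posDef_smul_add_smul hL hrel hone hκ hρ
  set S := L 0 + L 2 with hS
  set W := κ • L 3 + ρ • L 1 with hW
  have hdet : IsUnit S.det := (Matrix.isUnit_iff_isUnit_det _).mp hSpd.isUnit
  have hGS : S⁻¹ * S = 1 := Matrix.nonsing_inv_mul _ hdet
  have hSG : S * S⁻¹ = 1 := Matrix.mul_nonsing_inv _ hdet
  have hL2 : L 2 = S - L 0 := by rw [hS]; abel
  have hcomm : L 2 * S⁻¹ * L 0 = L 0 * S⁻¹ * L 2 := by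
    rw [hL2, Matrix.sub_mul, hSG, Matrix.mul_sub, Matrix.mul_assoc _ _ S, hGS, Matrix.sub_mul,
      Matrix.one_mul, Matrix.mul_one]
  have hherm : (L 0 * S⁻¹ * L 2)ᴴ = L 0 * S⁻¹ * L 2 := by
    rw [Matrix.conjTranspose_mul, Matrix.conjTranspose_mul, (hL 0).isHermitian,
      (hL 2).isHermitian, hSpd.inv.isHermitian, ← Matrix.mul_assoc, hcomm]
  have hzero : (L 0 * S⁻¹ * L 2)ᴴ * W * (L 0 * S⁻¹ * L 2) = 0 := by
    rw [hherm]
    calc L 0 * S⁻¹ * L 2 * W * (L 0 * S⁻¹ * L 2)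
        = L 2 * S⁻¹ * (L 0 * W * L 2) * S⁻¹ * L 0 := by
          rw [← hcomm]; simp only [Matrix.mul_assoc]
      _ = 0 := by rw [h]; simp
  refine Matrix.ext_of_mulVec_single fun j => ?_
  rw [Matrix.zero_mulVec]
  by_contra hne
  have hpos := hWpd.dotProduct_mulVec_pos hne
  have : star ((L 0 * S⁻¹ * L 2) *ᵥ Pi.single j 1) ⬝ᵥ W *ᵥ (L 0 * S⁻¹ * L 2) *ᵥ Pi.single j 1 =
      star (Pi.single j (1 : ℝ)) ⬝ᵥ
        ((L 0 * S⁻¹ * L 2)ᴴ * W * (L 0 * S⁻¹ * L 2)) *ᵥ Pi.single j 1 := by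
    rw [Matrix.star_mulVec, ← Matrix.dotProduct_mulVec, Matrix.mulVec_mulVec,
      Matrix.mulVec_mulVec, ← Matrix.mul_assoc]
  rw [this, hzero, Matrix.zero_mulVec, dotProduct_zero] at hpos
  exact hpos.false

end Positivity

/-! ### Normalised edge forms and their linear parts. -/

/-- Four normalised affine forms `e j + u j * x + v j * y` whose opposite pairs have the same sum
`S`, together with an expression of the constant `1` through the first two and `S`. -/
structure QuadPencil where
  (e u v : Fin 4 → ℝ)
  (a b c : ℝ)
  e_pos : ∀ j, 0 < e j
  rel_e : e 0 + e 2 = e 1 + e 3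
  rel_u : u 0 + u 2 = u 1 + u 3
  rel_v : v 0 + v 2 = v 1 + v 3
  one_e : a * e 0 + b * e 1 + c * (e 0 + e 2) = 1
  one_u : a * u 0 + b * u 1 + c * (u 0 + u 2) = 0
  one_v : a * v 0 + b * v 1 + c * (v 0 + v 2) = 0
  sum_eq : a + b + 2 * c = 1
  c_pos : 0 < c
  ac_pos : 0 < a + c
  bc_pos : 0 < b + c
  abc_pos : 0 < a + b + c
  indep : u 0 * v 1 - u 1 * v 0 ≠ 0

namespace QuadPencil

variable (T : QuadPencil) {n m : ℕ}

/-- The value of the `j`-th affine form at a pair of matrices. -/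
def form (j : Fin 4) (X : MatTuple 2 n) : Matrix (Fin n) (Fin n) ℝ :=
  T.e j • 1 + T.u j • X 0 + T.v j • X 1

/-- The linear part of the `j`-th affine form, at a pair of rectangular matrices. -/
def linearPart (j : Fin 4) (β : Fin 2 → Matrix (Fin n) (Fin m) ℝ) : Matrix (Fin n) (Fin m) ℝ :=
  T.u j • β 0 + T.v j • β 1

/-- Exchanging the two pairs of opposite forms. -/
def swap : QuadPencil where
  e := T.e ∘ ![1, 0, 3, 2]
  u := T.u ∘ ![1, 0, 3, 2]
  v := T.v ∘ ![1, 0, 3, 2]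
  a := T.b
  b := T.a
  c := T.c
  e_pos _ := T.e_pos _
  rel_e := T.rel_e.symm
  rel_u := T.rel_u.symm
  rel_v := T.rel_v.symm
  one_e := by
    have h1 := T.one_e
    have h2 := T.rel_e
    rw [h2] at h1
    simp only [Function.comp, Matrix.cons_val]
    linarith
  one_u := by
    have h1 := T.one_u
    have h2 := T.rel_u
    rw [h2] at h1
    simp only [Function.comp, Matrix.cons_val]
    linarith
  one_v := by
    have h1 := T.one_v
    have h2 := T.rel_v
    rw [h2] at h1
    simp only [Function.comp, Matrix.cons_val]
    linarith
  sum_eq := by linarith [T.sum_eq]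
  c_pos := T.c_pos
  ac_pos := T.bc_pos
  bc_pos := T.ac_pos
  abc_pos := by linarith [T.abc_pos]
  indep := by
    have h := T.indep
    simp only [Function.comp, Matrix.cons_val]
    intro h'
    apply h
    linarith

theorem swap_form (j : Fin 4) (X : MatTuple 2 n) :
    T.swap.form j X = T.form (![1, 0, 3, 2] j) X := rfl

theorem form_add_form (X : MatTuple 2 n) :
    T.form 0 X + T.form 2 X = T.form 1 X + T.form 3 X := by
  have h0 := T.rel_e
  have h1 := T.rel_u
  have h2 := T.rel_v
  calc T.form 0 X + T.form 2 X
      = (T.e 0 + T.e 2) • 1 + (T.u 0 + T.u 2) • X 0 + (T.v 0 + T.v 2) • X 1 := by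
        simp only [form]; module
    _ = _ := by rw [h0, h1, h2]; simp only [form]; module

theorem combination_eq_one (X : MatTuple 2 n) :
    T.a • T.form 0 X + T.b • T.form 1 X + T.c • (T.form 0 X + T.form 2 X) = 1 := by
  calc _ = (T.a * T.e 0 + T.b * T.e 1 + T.c * (T.e 0 + T.e 2)) • (1 : Matrix (Fin n) (Fin n) ℝ) +
        (T.a * T.u 0 + T.b * T.u 1 + T.c * (T.u 0 + T.u 2)) • X 0 +
        (T.a * T.v 0 + T.b * T.v 1 + T.c * (T.v 0 + T.v 2)) • X 1 := by
        simp only [form]; module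
    _ = 1 := by rw [T.one_e, T.one_u, T.one_v]; simp

theorem linearPart_add (β : Fin 2 → Matrix (Fin n) (Fin m) ℝ) :
    T.linearPart 0 β + T.linearPart 2 β = T.linearPart 1 β + T.linearPart 3 β := by
  calc _ = (T.u 0 + T.u 2) • β 0 + (T.v 0 + T.v 2) • β 1 := by simp only [linearPart]; module
    _ = _ := by rw [T.rel_u, T.rel_v]; simp only [linearPart]; module

theorem linearPart_combination (β : Fin 2 → Matrix (Fin n) (Fin m) ℝ) :
    T.a • T.linearPart 0 β + T.b • T.linearPart 1 β +
      T.c • (T.linearPart 0 β + T.linearPart 2 β) = 0 := by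
  calc _ = (T.a * T.u 0 + T.b * T.u 1 + T.c * (T.u 0 + T.u 2)) • β 0 +
        (T.a * T.v 0 + T.b * T.v 1 + T.c * (T.v 0 + T.v 2)) • β 1 := by
        simp only [linearPart]; module
    _ = 0 := by rw [T.one_u, T.one_v]; simp

theorem eq_zero_of_linearPart_eq_zero {β : Fin 2 → Matrix (Fin n) (Fin m) ℝ}
    (h0 : T.linearPart 0 β = 0) (h1 : T.linearPart 1 β = 0) : β = 0 := by
  have e0 : (T.u 0 * T.v 1 - T.u 1 * T.v 0) • β 0 = 0 := by
    calc _ = T.v 1 • T.linearPart 0 β - T.v 0 • T.linearPart 1 β := by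
          simp only [linearPart]; module
      _ = 0 := by simp [h0, h1]
  have e1 : (T.u 0 * T.v 1 - T.u 1 * T.v 0) • β 1 = 0 := by
    calc _ = T.u 0 • T.linearPart 1 β - T.u 1 • T.linearPart 0 β := by
          simp only [linearPart]; module
      _ = 0 := by simp [h0, h1]
  funext i
  fin_cases i
  · exact (smul_eq_zero.mp e0).resolve_left T.indep
  · exact (smul_eq_zero.mp e1).resolve_left T.indep

/-- Prescribed values of two linear parts. -/
theorem exists_linearPart_eq (w₀ w₁ : Matrix (Fin n) (Fin m) ℝ) :
    ∃ β : Fin 2 → Matrix (Fin n) (Fin m) ℝ, T.linearPart 0 β = w₀ ∧ T.linearPart 1 β = w₁ := by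
  set D := T.u 0 * T.v 1 - T.u 1 * T.v 0 with hD
  have hD0 : D ≠ 0 := T.indep
  refine ⟨![D⁻¹ • (T.v 1 • w₀ - T.v 0 • w₁), D⁻¹ • (T.u 0 • w₁ - T.u 1 • w₀)], ?_, ?_⟩
  · calc _ = (D⁻¹ * D) • w₀ := by
          simp only [linearPart, Matrix.cons_val_zero, Matrix.cons_val_one, hD]; module
      _ = w₀ := by rw [inv_mul_cancel₀ hD0, one_smul]
  · calc _ = (D⁻¹ * D) • w₁ := by
          simp only [linearPart, Matrix.cons_val_zero, Matrix.cons_val_one, hD]; module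
      _ = w₁ := by rw [inv_mul_cancel₀ hD0, one_smul]

theorem form_blockTuple (j : Fin 4) (X : MatTuple 2 n) (β : Fin 2 → Matrix (Fin n) (Fin m) ℝ)
    (γ : MatTuple 2 m) :
    T.form j (blockTuple X β γ) = Matrix.reindex finSumFinEquiv finSumFinEquiv
      (Matrix.fromBlocks (T.form j X) (T.linearPart j β) (T.linearPart j β)ᵀ (T.form j γ)) := by
  ext p q
  obtain ⟨p, rfl⟩ := finSumFinEquiv.surjective p
  obtain ⟨q, rfl⟩ := finSumFinEquiv.surjective q
  have h1 : (1 : Matrix (Fin (n + m)) (Fin (n + m)) ℝ) (finSumFinEquiv p) (finSumFinEquiv q) =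
      (Matrix.fromBlocks 1 0 0 1 : Matrix (Fin n ⊕ Fin m) (Fin n ⊕ Fin m) ℝ) p q := by
    rw [Matrix.fromBlocks_one]
    simp [Matrix.one_apply]
  simp only [form, Matrix.add_apply, Matrix.smul_apply, h1, blockTuple, Matrix.reindex_apply,
    Matrix.submatrix_apply, Equiv.symm_apply_apply]
  rcases p with p | p <;> rcases q with q | q <;> simp [linearPart]

end QuadPencil

/-! ### Positive semidefinite block matrices. -/

/-- For a column `x` of `D`, the vector `(x, 0)` is isotropic for a positive semidefinite matrix,
hence in its kernel. -/
theorem transpose_mul_eq_zero_of_posSemidef_fromBlocks {n m r : ℕ} {L : Matrix (Fin n) (Fin n) ℝ}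
    {W : Matrix (Fin n) (Fin m) ℝ} {Γ : Matrix (Fin m) (Fin m) ℝ}
    (h : (Matrix.fromBlocks L W Wᵀ Γ).PosSemidef) {D : Matrix (Fin n) (Fin r) ℝ}
    (hD : L * D = 0) : Wᵀ * D = 0 := by
  refine Matrix.ext_of_mulVec_single fun j => ?_
  rw [Matrix.zero_mulVec]
  have h1 : Matrix.fromBlocks L W Wᵀ Γ *ᵥ Sum.elim (D *ᵥ Pi.single j 1) 0 =
      Sum.elim (0 : Fin n → ℝ) ((Wᵀ * D) *ᵥ Pi.single j 1) := by
    rw [Matrix.fromBlocks_mulVec]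
    simp only [Sum.elim_comp_inl, Sum.elim_comp_inr, Matrix.mulVec_zero, add_zero,
      Matrix.mulVec_mulVec, hD, Matrix.zero_mulVec]
  have h2 := (h.dotProduct_mulVec_zero_iff (Sum.elim (D *ᵥ Pi.single j 1) 0)).mp (by
    rw [h1]
    simp [dotProduct])
  rw [h1] at h2
  funext k
  exact congrFun h2 (Sum.inr k)

/-- Schur complement: the block matrix is `(1 z)ᵀ L (1 z)` plus `0 ⊕ (Γ - zᵀ L z)`. -/
theorem posSemidef_fromBlocks_mul {n m : ℕ} {L : Matrix (Fin n) (Fin n) ℝ} (hL : L.PosSemidef)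
    (z : Matrix (Fin n) (Fin m) ℝ) {Γ : Matrix (Fin m) (Fin m) ℝ}
    (hΓ : (Γ - zᵀ * L * z).PosSemidef) :
    (Matrix.fromBlocks L (L * z) (L * z)ᵀ Γ).PosSemidef := by
  have hLt : Lᵀ = L := by
    have := hL.isHermitian
    rwa [Matrix.IsHermitian, Matrix.conjTranspose_eq_transpose_of_trivial] at this
  have h1 := hL.conjTranspose_mul_mul_same (Matrix.fromCols (1 : Matrix (Fin n) (Fin n) ℝ) z)
  have h2 := hΓ.conjTranspose_mul_mul_same
    (Matrix.fromCols (0 : Matrix (Fin m) (Fin n) ℝ) (1 : Matrix (Fin m) (Fin m) ℝ))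
  convert h1.add h2 using 1
  rw [Matrix.conjTranspose_eq_transpose_of_trivial, Matrix.conjTranspose_eq_transpose_of_trivial,
    Matrix.transpose_fromCols, Matrix.transpose_fromCols, Matrix.fromRows_mul,
    Matrix.fromRows_mul_fromCols, Matrix.fromRows_mul, Matrix.fromRows_mul_fromCols, Matrix.fromBlocks_add]
  simp [hLt]

theorem exists_sq_mul_le (q e : Fin 4 → ℝ) (he : ∀ j, 0 < e j) :
    ∃ t : ℝ, t ≠ 0 ∧ ∀ j, t ^ 2 * q j ≤ e j := by
  have h : ∀ j, ∀ᶠ t : ℝ in nhdsWithin 0 {0}ᶜ, t ^ 2 * q j < e j := by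
    intro j
    have hc : ContinuousAt (fun t : ℝ => t ^ 2 * q j) 0 := by fun_prop
    exact (hc.eventually_lt_const (by simpa using he j)).filter_mono nhdsWithin_le_nhds
  obtain ⟨t, ht, ht0⟩ := ((Filter.eventually_all.mpr h).and self_mem_nhdsWithin).exists
  exact ⟨t, ht0, fun j => (ht j).le⟩

/-- The columns of `G L'` lie in `ker L` and those of `G L` in `ker L'`, so the cross terms `L' G W`
and `L G W'` vanish. -/
theorem mul_mul_add_eq_of_complementary {n m : ℕ} {L L' G : Matrix (Fin n) (Fin n) ℝ}
    {W W' : Matrix (Fin n) (Fin m) ℝ} (hL : Lᵀ = L) (hL' : L'ᵀ = L') (hG : Gᵀ = G)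
    (hSG : (L + L') * G = 1) (h : L * G * L' = 0)
    (hW : ∀ D : Matrix (Fin n) (Fin n) ℝ, L * D = 0 → Wᵀ * D = 0)
    (hW' : ∀ D : Matrix (Fin n) (Fin n) ℝ, L' * D = 0 → W'ᵀ * D = 0) :
    L * G * (W + W') = W := by
  have h' : L' * (G * L) = 0 := by
    have := congrArg Matrix.transpose h
    rwa [Matrix.transpose_mul, Matrix.transpose_mul, hL, hL', hG, Matrix.transpose_zero] at this
  have e1 : L * G * W' = 0 := by
    have := congrArg Matrix.transpose (hW' _ h')
    rwa [Matrix.transpose_mul, Matrix.transpose_mul, hL, hG, Matrix.transpose_transpose,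
      Matrix.transpose_zero] at this
  have e2 : L' * G * W = 0 := by
    have := congrArg Matrix.transpose (hW _ ((Matrix.mul_assoc _ _ _).symm.trans h))
    rwa [Matrix.transpose_mul, Matrix.transpose_mul, hL', hG, Matrix.transpose_transpose,
      Matrix.transpose_zero] at this
  calc L * G * (W + W') = L * G * W + L' * G * W := by rw [Matrix.mul_add, e1, e2]
    _ = (L + L') * G * W := by rw [Matrix.add_mul, Matrix.add_mul]
    _ = W := by rw [hSG, Matrix.one_mul]

/-! ### The Arveson boundary as complementarity of both opposite pairs. -/

namespace QuadPencil

variable (T : QuadPencil) {n d : ℕ} {A : MatTuple 2 d}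

/-- `T` describes the free spectrahedron of `A`. -/
def Describes (T : QuadPencil) (A : MatTuple 2 d) : Prop :=
  ∀ (n : ℕ) (X : MatTuple 2 n),
    X ∈ freeSpectrahedron A n ↔ (∀ i, (X i).IsSymm) ∧ ∀ j, (T.form j X).PosSemidef

theorem Describes.swap {T : QuadPencil} (hT : T.Describes A) : T.swap.Describes A := by
  intro n X
  rw [hT n X]
  refine and_congr_right fun _ => ⟨fun h j => h _, fun h j => ?_⟩
  have := h (![1, 0, 3, 2] j)
  rw [swap_form] at this
  fin_cases j <;> exact this

variable {T}

/-- Write `Λ j` for the linear parts of a dilation and `Λ = Λ 0 + Λ 2`. Complementarity gives `Λ 0 =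
L 0 G Λ` and `Λ 1 = L 1 G Λ`; inserted into `a Λ 0 + b Λ 1 + c Λ = 0`, this reads `G Λ = 0`. -/
theorem Describes.mem_arvesonBoundary (hT : T.Describes A) {X : MatTuple 2 n}
    (hX : X ∈ freeSpectrahedron A n)
    (h02 : T.form 0 X * (T.form 0 X + T.form 2 X)⁻¹ * T.form 2 X = 0)
    (h13 : T.form 1 X * (T.form 0 X + T.form 2 X)⁻¹ * T.form 3 X = 0) :
    X ∈ arvesonBoundary (freeSpectrahedron A) n := by
  refine ⟨hX, fun m β γ hβ => ?_⟩
  have hL := ((hT n X).mp hX).2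
  have hrel := T.form_add_form X
  have hone := T.combination_eq_one X
  have hSpd := posDef_add_zero_two (L := fun j => T.form j X) hL hrel hone
  have hB : ∀ j, (Matrix.fromBlocks (T.form j X) (T.linearPart j β) (T.linearPart j β)ᵀ
      (T.form j γ)).PosSemidef := fun j => by
    have := ((hT _ _).mp hβ).2 j
    rw [form_blockTuple, Matrix.reindex_apply, Matrix.posSemidef_submatrix_equiv] at this
    exact this
  have hker : ∀ j (D : Matrix (Fin n) (Fin n) ℝ), T.form j X * D = 0 →
      (T.linearPart j β)ᵀ * D = 0 := fun j _ hD =>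
    transpose_mul_eq_zero_of_posSemidef_fromBlocks (hB j) hD
  have hLt : ∀ j, (T.form j X)ᵀ = T.form j X := fun j => by
    have := (hL j).isHermitian
    rwa [Matrix.IsHermitian, Matrix.conjTranspose_eq_transpose_of_trivial] at this
  beta_reduce at hSpd
  set S := T.form 0 X + T.form 2 X with hS
  have hdet : IsUnit S.det := (Matrix.isUnit_iff_isUnit_det _).mp hSpd.isUnit
  have hSG : S * S⁻¹ = 1 := Matrix.mul_nonsing_inv _ hdet
  have hGt : (S⁻¹)ᵀ = S⁻¹ := by
    have := hSpd.inv.isHermitian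
    rwa [Matrix.IsHermitian, Matrix.conjTranspose_eq_transpose_of_trivial] at this
  have e0 := mul_mul_add_eq_of_complementary (hLt 0) (hLt 2) hGt hSG h02 (hker 0) (hker 2)
  have e1 := mul_mul_add_eq_of_complementary (hLt 1) (hLt 3) hGt (hrel ▸ hSG) h13 (hker 1)
    (hker 3)
  rw [← T.linearPart_add β] at e1
  have hcomb := T.linearPart_combination β
  set W := T.linearPart 0 β + T.linearPart 2 β with hW
  have hGW : S⁻¹ * W = 0 := by
    calc S⁻¹ * W = (T.a • T.form 0 X + T.b • T.form 1 X + T.c • S) * (S⁻¹ * W) := by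
          rw [hone, Matrix.one_mul]
      _ = T.a • (T.form 0 X * S⁻¹ * W) + T.b • (T.form 1 X * S⁻¹ * W) + T.c • (S * S⁻¹ * W) := by
          simp only [Matrix.add_mul, Matrix.smul_mul, Matrix.mul_assoc]
      _ = 0 := by rw [e0, e1, hSG, Matrix.one_mul, hcomb]
  rw [Matrix.mul_assoc, hGW, Matrix.mul_zero] at e0 e1
  exact T.eq_zero_of_linearPart_eq_zero e0.symm e1.symm

theorem Describes.complementary_of_mem_arvesonBoundary (hT : T.Describes A) {X : MatTuple 2 n}
    (hX : X ∈ arvesonBoundary (freeSpectrahedron A) n) :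
    T.form 0 X * (T.form 0 X + T.form 2 X)⁻¹ * T.form 2 X = 0 := by
  have hXs := ((hT n X).mp hX.1).1
  have hL := ((hT n X).mp hX.1).2
  have hrel := T.form_add_form X
  have hone := T.combination_eq_one X
  have hSpd := posDef_add_zero_two (L := fun j => T.form j X) hL hrel hone
  beta_reduce at hSpd
  set S := T.form 0 X + T.form 2 X with hS
  have hdet : IsUnit S.det := (Matrix.isUnit_iff_isUnit_det _).mp hSpd.isUnit
  have hGS : S⁻¹ * S = 1 := Matrix.nonsing_inv_mul _ hdet
  have hSG : S * S⁻¹ = 1 := Matrix.mul_nonsing_inv _ hdet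
  have hL2 : T.form 2 X = S - T.form 0 X := by rw [hS]; abel
  have hcomm : T.form 2 X * S⁻¹ * T.form 0 X = T.form 0 X * S⁻¹ * T.form 2 X := by
    rw [hL2, Matrix.sub_mul, hSG, Matrix.mul_sub, Matrix.mul_assoc _ _ S, hGS, Matrix.sub_mul,
      Matrix.one_mul, Matrix.mul_one]
  refine Matrix.ext_of_mulVec_single fun k => ?_
  rw [Matrix.zero_mulVec]
  let p : Matrix (Fin n) (Fin 1) ℝ := Matrix.replicateCol (Fin 1) (Pi.single k 1)
  suffices hr : T.form 0 X * S⁻¹ * T.form 2 X * p = 0 by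
    funext i
    exact congrFun (congrFun hr i) 0
  set r := T.form 0 X * S⁻¹ * T.form 2 X * p with hr
  -- The `L j z j` must obey the relations between linear parts. Both opposite sums equal `S y`, and
  -- the combination with `a`, `b`, `c` is `a r + y`, whence `y = -a r`.
  let y := -(T.a • r)
  let z : Fin 4 → Matrix (Fin n) (Fin 1) ℝ :=
    ![S⁻¹ * T.form 2 X * p + y, y, y - S⁻¹ * T.form 0 X * p, y]
  have hw0 : T.form 0 X * z 0 = r + T.form 0 X * y := by
    simp only [z, Matrix.cons_val_zero, Matrix.mul_add, hr, Matrix.mul_assoc]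
  have hw2 : T.form 2 X * z 2 = T.form 2 X * y - r := by
    simp only [z, Matrix.cons_val, Matrix.mul_sub, hr, ← Matrix.mul_assoc, hcomm]
  have hw1 : T.form 1 X * z 1 = T.form 1 X * y := rfl
  have hw3 : T.form 3 X * z 3 = T.form 3 X * y := rfl
  obtain ⟨β, hβ0, hβ1⟩ := T.exists_linearPart_eq (T.form 0 X * z 0) (T.form 1 X * z 1)
  have hy : T.a • (T.form 0 X * z 0) + T.b • (T.form 1 X * z 1) +
      T.c • (T.form 0 X * z 0 + T.form 2 X * z 2) = 0 := by
    calc _ = (T.a • T.form 0 X + T.b • T.form 1 X + T.c • S) * y + T.a • r := by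
          rw [hw0, hw1, hw2, hS]
          simp only [Matrix.add_mul, Matrix.smul_mul]
          module
      _ = 0 := by rw [hone, Matrix.one_mul]; exact neg_add_cancel _
  have hβ2 : T.linearPart 2 β = T.form 2 X * z 2 := by
    have h1 := T.linearPart_combination β
    rw [hβ0, hβ1, ← hy] at h1
    exact add_left_cancel (smul_right_injective _ T.c_pos.ne' (add_left_cancel h1))
  have hβ3 : T.linearPart 3 β = T.form 3 X * z 3 := by
    have h1 := T.linearPart_add β
    rw [hβ0, hβ1, hβ2, hw0, hw2, hw1] at h1
    have h2 : T.form 1 X * y + T.linearPart 3 β = T.form 1 X * y + T.form 3 X * y := by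
      rw [← h1, ← Matrix.add_mul, ← hrel, hS, Matrix.add_mul]
      abel
    rw [hw3]
    exact add_left_cancel h2
  have hβ : ∀ j, T.linearPart j β = T.form j X * z j := by
    intro j
    fin_cases j
    exacts [hβ0, hβ1, hβ2, hβ3]
  -- At `γ = 0` the corner entry is `e j > 0`, which dominates the Schur term of a small multiple of
  -- `β`.
  obtain ⟨t, ht0, ht⟩ :=
    exists_sq_mul_le (fun j => ((z j)ᵀ * T.form j X * z j) 0 0) T.e T.e_pos
  have hmem : blockTuple X (fun i => t • β i) (0 : MatTuple 2 1) ∈ freeSpectrahedron A (n + 1) := by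
    rw [hT]
    refine ⟨fun i => ?_, fun j => ?_⟩
    · rw [blockTuple, Matrix.reindex_apply]
      exact Matrix.IsSymm.submatrix (Matrix.IsSymm.fromBlocks (hXs i) rfl Matrix.isSymm_zero) _
    · rw [form_blockTuple, Matrix.reindex_apply, Matrix.posSemidef_submatrix_equiv]
      have hlin : T.linearPart j (fun i => t • β i) = T.form j X * (t • z j) := by
        rw [Matrix.mul_smul, ← hβ]
        simp only [linearPart]
        module
      rw [hlin]
      refine posSemidef_fromBlocks_mul (hL j) _ ?_
      have hone1 : T.form j (0 : MatTuple 2 1) - (t • z j)ᵀ * T.form j X * (t • z j) =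
          Matrix.diagonal fun _ => T.e j - t ^ 2 * ((z j)ᵀ * T.form j X * z j) 0 0 := by
        ext p q
        obtain rfl := Subsingleton.elim p 0
        obtain rfl := Subsingleton.elim q 0
        simp [form]
        ring
      rw [hone1]
      exact Matrix.PosSemidef.diagonal fun _ => sub_nonneg.mpr (ht j)
  have hβzero : β = 0 := by
    have := hX.2 1 _ _ hmem
    funext i
    exact (smul_eq_zero.mp (congrFun this i)).resolve_left ht0
  have hlz : ∀ j, T.form j X * z j = 0 := fun j => by
    rw [← hβ, hβzero]
    simp [linearPart]
  have hSy : S * y = 0 := by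
    calc S * y = T.form 0 X * z 0 + T.form 2 X * z 2 := by
          rw [hw0, hw2, hS, Matrix.add_mul]; abel
      _ = 0 := by rw [hlz, hlz, add_zero]
  have hy0 : y = 0 := by
    calc y = S⁻¹ * (S * y) := by rw [← Matrix.mul_assoc, hGS, Matrix.one_mul]
      _ = 0 := by rw [hSy, Matrix.mul_zero]
  have := hlz 0
  rwa [hw0, hy0, Matrix.mul_zero, add_zero] at this

end QuadPencil

/-! ### Plane geometry of the quadrilateral. -/

/-- Radon: the two diagonals of a convex quadrilateral intersect in their interiors. -/
theorem exists_diagonals_intersect {v : Fin 4 → (Fin 2 → ℝ)} (hv : ConvexIndependent ℝ v) :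
    ∃ (σ : Equiv.Perm (Fin 4)) (l m : ℝ), 0 < l ∧ l < 1 ∧ 0 < m ∧ m < 1 ∧
      l • v (σ 0) + (1 - l) • v (σ 2) = m • v (σ 1) + (1 - m) • v (σ 3) := by
  classical
  have hdep : ¬ AffineIndependent ℝ v := by
    intro h
    have := h.card_le_finrank_succ
    have h2 : Module.finrank ℝ (vectorSpan ℝ (Set.range v)) ≤ 2 := by
      simpa using Submodule.finrank_le (vectorSpan ℝ (Set.range v))
    simp only [Fintype.card_fin] at this
    omega
  obtain ⟨I, p, hpI, hpI'⟩ := Convex.radon_partition hdep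
  have hsub : ∀ (I : Set (Fin 4)) (i : Fin 4), I ⊆ {i} → p ∈ convexHull ℝ (v '' I) →
      p ∈ convexHull ℝ (v '' Iᶜ) → False := by
    intro I i hI h1 h2
    rcases Set.subset_singleton_iff_eq.mp hI with rfl | rfl
    · simp at h1
    · rw [Set.image_singleton, convexHull_singleton, Set.mem_singleton_iff] at h1
      subst h1
      exact hv _ _ h2 rfl
  -- A Radon part with at most one index contradicts convex independence, so the split is two
  -- against two.
  have hcomb : ∀ J : Finset (Fin 4), (∃ i, J ⊆ {i}) ∨ (∃ i, Jᶜ ⊆ {i}) ∨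
      ∃ σ : Equiv.Perm (Fin 4), J = {σ 0, σ 2} ∧ Jᶜ = {σ 1, σ 3} := by decide
  have hI : (I.toFinset : Set (Fin 4)) = I := by simp
  have hI' : ((I.toFinsetᶜ : Finset (Fin 4)) : Set (Fin 4)) = Iᶜ := by simp
  rcases hcomb I.toFinset with ⟨i, hi⟩ | ⟨i, hi⟩ | ⟨σ, h1, h2⟩
  · refine (hsub I i ?_ hpI hpI').elim
    rw [← hI]
    exact_mod_cast hi
  · refine (hsub Iᶜ i ?_ hpI' (by rwa [compl_compl])).elim
    rw [← hI']
    exact_mod_cast hi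
  · rw [h1] at hI
    rw [h2] at hI'
    push_cast at hI hI'
    rw [← hI] at hpI
    rw [← hI'] at hpI'
    rw [Set.image_pair, convexHull_pair] at hpI hpI'
    have hend : ∀ i, p = v i → i ∈ ({σ 0, σ 2} : Set (Fin 4)) ∧ i ∈ ({σ 1, σ 3} : Set (Fin 4)) := by
      rintro i rfl
      exact ⟨hv _ _ (by rwa [Set.image_pair, convexHull_pair]),
        hv _ _ (by rwa [Set.image_pair, convexHull_pair])⟩
    have hend' : ∀ k, p ≠ v (σ k) := by
      intro k h
      have := hend _ h
      simp only [Set.mem_insert_iff, Set.mem_singleton_iff, σ.injective.eq_iff] at this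
      have hdisj : ∀ k : Fin 4, ¬ ((k = 0 ∨ k = 2) ∧ (k = 1 ∨ k = 3)) := by decide
      exact hdisj k this
    obtain ⟨l, l', hl, hl', hll, hp⟩ := hpI
    obtain ⟨m, m', hm, hm', hmm, hp'⟩ := hpI'
    obtain rfl : l' = 1 - l := by linarith
    obtain rfl : m' = 1 - m := by linarith
    refine ⟨σ, l, m, hl.lt_of_ne ?_, (sub_nonneg.mp hl').lt_of_ne ?_, hm.lt_of_ne ?_,
      (sub_nonneg.mp hm').lt_of_ne ?_, hp.trans hp'.symm⟩
    · rintro rfl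
      exact hend' 2 (by simpa using hp.symm)
    · rintro rfl
      exact hend' 0 (by simpa using hp.symm)
    · rintro rfl
      exact hend' 3 (by simpa using hp'.symm)
    · rintro rfl
      exact hend' 1 (by simpa using hp'.symm)

/-- The affine function with the given coefficients. -/
def affineForm (α β γ : ℝ) (x : Fin 2 → ℝ) : ℝ := α + β * x 0 + γ * x 1

theorem affineForm_combination (α β γ s t : ℝ) (h : s + t = 1) (x y : Fin 2 → ℝ) :
    affineForm α β γ (s • x + t • y) = s * affineForm α β γ x + t * affineForm α β γ y := by
  obtain rfl : t = 1 - s := by linarith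
  simp only [affineForm, Pi.add_apply, Pi.smul_apply, smul_eq_mul]
  ring

/-- The polygon cut out by the four inequalities `0 ≤ 1 + b i * x + c i * y`. -/
def polygon (b c : Fin 4 → ℝ) : Set (Fin 2 → ℝ) := {x | ∀ i, 0 ≤ affineForm 1 (b i) (c i) x}

section Polygon

variable {b c : Fin 4 → ℝ} {v : Fin 4 → (Fin 2 → ℝ)}

theorem affineForm_nonneg_of_vertices (hS : polygon b c = convexHull ℝ (Set.range v)) {α β γ : ℝ}
    (h : ∀ k, 0 ≤ affineForm α β γ (v k)) : ∀ x ∈ polygon b c, 0 ≤ affineForm α β γ x := by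
  rw [hS]
  refine fun x hx => convexHull_min (s := Set.range v) (t := {x | 0 ≤ affineForm α β γ x}) ?_ ?_ hx
  · rintro _ ⟨k, rfl⟩
    exact h k
  · intro x hx y hy s t hs ht hst
    change 0 ≤ affineForm α β γ _
    rw [affineForm_combination _ _ _ _ _ hst]
    exact add_nonneg (mul_nonneg hs hx) (mul_nonneg ht hy)

/-- Such a function vanishes on the whole polygon, which contains a neighbourhood of `0` because the
constant terms are `1`. -/
theorem coeff_eq_zero_of_vertices (hS : polygon b c = convexHull ℝ (Set.range v)) {α β γ : ℝ}
    (h : ∀ k, affineForm α β γ (v k) = 0) : α = 0 ∧ β = 0 ∧ γ = 0 := by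
  have hz : ∀ x ∈ polygon b c, affineForm α β γ x = 0 := by
    intro x hx
    refine le_antisymm ?_ (affineForm_nonneg_of_vertices hS (fun k => (h k).ge) x hx)
    have := affineForm_nonneg_of_vertices hS (α := -α) (β := -β) (γ := -γ)
      (fun k => by have := h k; simp only [affineForm] at this ⊢; linarith) x hx
    simp only [affineForm] at this ⊢
    linarith
  have hsmall : ∀ w : Fin 4 → ℝ, ∃ t : ℝ, t ≠ 0 ∧ ∀ i, t * w i ≤ 1 := by
    intro w
    obtain ⟨t, ht0, ht⟩ := exists_sq_mul_le w (fun _ => 1) fun _ => one_pos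
    exact ⟨t ^ 2, pow_ne_zero 2 ht0, ht⟩
  have h0 : α = 0 := by
    have := hz 0 (fun i => by simp [affineForm])
    simpa [affineForm] using this
  refine ⟨h0, ?_, ?_⟩
  · obtain ⟨t, ht0, ht⟩ := hsmall fun i => -b i
    have := hz ![t, 0] (fun i => by have := ht i; simp [affineForm]; linarith)
    simpa [affineForm, h0, ht0] using this
  · obtain ⟨t, ht0, ht⟩ := hsmall fun i => -c i
    have := hz ![0, t] (fun i => by have := ht i; simp [affineForm]; linarith)
    simpa [affineForm, h0, ht0] using this

/-- Every edge of a quadrilateral lies on one of the four bounding lines. -/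
theorem exists_edge (hS : polygon b c = convexHull ℝ (Set.range v)) {l m : ℝ}
    (hl1 : l < 1) (hm1 : m < 1)
    (hrel : l • v 0 + (1 - l) • v 2 = m • v 1 + (1 - m) • v 3) (hne : v 0 ≠ v 1) :
    ∃ i, affineForm 1 (b i) (c i) (v 0) = 0 ∧ affineForm 1 (b i) (c i) (v 1) = 0 := by
  have hv : ∀ k i, 0 ≤ affineForm 1 (b i) (c i) (v k) := fun k => by
    have : v k ∈ polygon b c := hS ▸ subset_convexHull ℝ _ ⟨k, rfl⟩
    exact this
  -- The affine function vanishing on the line through `v 0` and `v 1`.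
  set γ := v 1 0 - v 0 0 with hγ
  set β := -(v 1 1 - v 0 1) with hβ
  set α := -(β * v 0 0 + γ * v 0 1) with hα
  have g0 : affineForm α β γ (v 0) = 0 := by simp only [affineForm, hα]; ring
  have g1 : affineForm α β γ (v 1) = 0 := by simp only [affineForm, hα, hβ, hγ]; ring
  have g23 : (1 - l) * affineForm α β γ (v 2) = (1 - m) * affineForm α β γ (v 3) := by
    have := congrArg (affineForm α β γ) hrel
    rwa [affineForm_combination _ _ _ _ _ (by ring), affineForm_combination _ _ _ _ _ (by ring),
      g0, g1, mul_zero, mul_zero, zero_add, zero_add] at this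
  have g2 : affineForm α β γ (v 2) ≠ 0 := by
    intro h
    have h3 : affineForm α β γ (v 3) = 0 := by
      rw [h, mul_zero] at g23
      exact (mul_eq_zero.mp g23.symm).resolve_left (by linarith)
    obtain ⟨-, e1, e2⟩ := coeff_eq_zero_of_vertices hS (α := α) (β := β) (γ := γ) (fun k => by
      fin_cases k
      exacts [g0, g1, h, h3])
    refine hne (funext fun i => ?_)
    fin_cases i
    · change v 0 0 = v 1 0
      linarith
    · change v 0 1 = v 1 1
      linarith
  obtain ⟨s, hs2⟩ : ∃ s : ℝ, 0 < s * affineForm α β γ (v 2) := ⟨_, mul_self_pos.mpr g2⟩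
  have hs3 : 0 < s * affineForm α β γ (v 3) := by
    have h1 := mul_pos (sub_pos.mpr hl1) hs2
    have h2 : (1 - l) * (s * affineForm α β γ (v 2)) = (1 - m) * (s * affineForm α β γ (v 3)) := by
      linear_combination s * g23
    rw [h2] at h1
    exact pos_of_mul_pos_right h1 (by linarith)
  have hsmul : ∀ x, affineForm (s * α) (s * β) (s * γ) x = s * affineForm α β γ x := by
    intro x
    simp only [affineForm]
    ring
  have hg := affineForm_nonneg_of_vertices hS (α := s * α) (β := s * β) (γ := s * γ) (fun k => by
    rw [hsmul]
    fin_cases k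
    exacts [by simp [g0], by simp [g1], hs2.le, hs3.le])
  by_contra! hcon
  -- If no bounding line contains the edge, its midpoint satisfies all inequalities strictly and can
  -- be pushed slightly away from `v 2` inside the polygon, to where the supporting function is
  -- negative.
  set w : Fin 2 → ℝ := (1 / 2 : ℝ) • v 0 + (1 / 2 : ℝ) • v 1 with hw
  have hwpos : ∀ i, 0 < affineForm 1 (b i) (c i) w := by
    intro i
    rw [hw, affineForm_combination _ _ _ _ _ (by norm_num)]
    have h0 := hv 0 i
    have h1 := hv 1 i
    rcases h0.eq_or_lt with h | h
    · have := lt_of_le_of_ne h1 (hcon i h.symm).symm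
      linarith
    · linarith
  obtain ⟨t, ht0, ht⟩ := exists_sq_mul_le (fun i => affineForm 1 (b i) (c i) (v 2)) _ hwpos
  have htpos : 0 < t ^ 2 := by positivity
  have hmem : (1 + t ^ 2) • w + (-t ^ 2) • v 2 ∈ polygon b c := by
    intro i
    rw [affineForm_combination _ _ _ _ _ (by ring)]
    have := ht i
    have := mul_pos htpos (hwpos i)
    linarith
  have h1 := hg _ hmem
  rw [hsmul, affineForm_combination _ _ _ _ _ (by ring), hw,
    affineForm_combination _ _ _ _ _ (by norm_num), g0, g1] at h1
  have := mul_pos htpos hs2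
  linarith

/-- With the forms scaled to `1` at the diagonal intersection, their values at the vertices are `0`,
`l⁻¹`, `(1 - l)⁻¹`, `m⁻¹` or `(1 - m)⁻¹`, so every relation can be checked there. -/
theorem exists_quadPencil_of_vertices (hS : polygon b c = convexHull ℝ (Set.range v)) {l m : ℝ}
    (hl0 : 0 < l) (hl1 : l < 1) (hm0 : 0 < m) (hm1 : m < 1)
    (hrel : l • v 0 + (1 - l) • v 2 = m • v 1 + (1 - m) • v 3) (hne : v.Injective) :
    ∃ (T : QuadPencil) (τ : Equiv.Perm (Fin 4)), ∀ k, 0 < T.e k ∧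
      T.u k = T.e k * b (τ k) ∧ T.v k = T.e k * c (τ k) := by
  have hrange : ∀ σ : Equiv.Perm (Fin 4), polygon b c = convexHull ℝ (Set.range (v ∘ σ)) :=
    fun σ => by rw [hS, σ.surjective.range_comp]
  have hedge : ∀ k, ∃ i, affineForm 1 (b i) (c i) (v k) = 0 ∧
      affineForm 1 (b i) (c i) (v (k + 1)) = 0 := by
    intro k
    -- Rotating the vertices cyclically sends `(l, m)` to `(m, 1 - l)`, which reduces every edge to
    -- the first.
    have hshift : ∀ l m : ℝ, l < 1 → m < 1 →
        l • v k + (1 - l) • v (k + 2) = m • v (k + 1) + (1 - m) • v (k + 3) →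
        ∃ i, affineForm 1 (b i) (c i) (v k) = 0 ∧ affineForm 1 (b i) (c i) (v (k + 1)) = 0 := by
      intro l m hl hm h
      have := exists_edge (v := v ∘ Equiv.addLeft k) (hrange _) hl hm (by simpa using h)
        (by simpa using hne.ne (by simp))
      simpa using this
    fin_cases k
    · exact hshift l m hl1 hm1 hrel
    · refine hshift m (1 - l) hm1 (by linarith) ?_
      change m • v 1 + (1 - m) • v 3 = (1 - l) • v 2 + (1 - (1 - l)) • v 0
      rw [← hrel]
      module
    · refine hshift (1 - l) (1 - m) (by linarith) (by linarith) ?_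
      change (1 - l) • v 2 + (1 - (1 - l)) • v 0 = (1 - m) • v 3 + (1 - (1 - m)) • v 1
      have := hrel
      rw [sub_sub_cancel, sub_sub_cancel, add_comm, hrel, add_comm]
    · refine hshift (1 - m) l (by linarith) hl1 ?_
      change (1 - m) • v 3 + (1 - (1 - m)) • v 1 = l • v 0 + (1 - l) • v 2
      rw [hrel]
      module
  choose i hi hi' using hedge
  set F : Fin 4 → Fin 4 → ℝ := fun k j => affineForm 1 (b (i k)) (c (i k)) (v j) with hF
  have hnn : ∀ k j, 0 ≤ F k j := fun k j => by
    have : v j ∈ polygon b c := hS ▸ subset_convexHull ℝ _ ⟨j, rfl⟩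
    exact this (i k)
  -- The value of the `k`-th form at the diagonal intersection.
  set P : Fin 4 → ℝ := fun k => l * F k 0 + (1 - l) * F k 2 with hP
  have hP' : ∀ k, P k = m * F k 1 + (1 - m) * F k 3 := by
    intro k
    have := congrArg (affineForm 1 (b (i k)) (c (i k))) hrel
    rwa [affineForm_combination _ _ _ _ _ (by ring), affineForm_combination _ _ _ _ _ (by ring)]
      at this
  have hl' : 0 < 1 - l := by linarith
  have hm' : 0 < 1 - m := by linarith
  have hPpos : ∀ k, 0 < P k := by
    intro k
    have h0 := mul_nonneg hl0.le (hnn k 0)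
    have h1 := mul_nonneg hm0.le (hnn k 1)
    have h2 := mul_nonneg hl'.le (hnn k 2)
    have h3 := mul_nonneg hm'.le (hnn k 3)
    by_contra hneg
    have hk := hP' k
    have hk' : P k = l * F k 0 + (1 - l) * F k 2 := rfl
    have e0 : F k 0 = 0 := (mul_eq_zero.mp (show l * F k 0 = 0 by linarith)).resolve_left hl0.ne'
    have e1 : F k 1 = 0 := (mul_eq_zero.mp (show m * F k 1 = 0 by linarith)).resolve_left hm0.ne'
    have e2 : F k 2 = 0 :=
      (mul_eq_zero.mp (show (1 - l) * F k 2 = 0 by linarith)).resolve_left hl'.ne'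
    have e3 : F k 3 = 0 :=
      (mul_eq_zero.mp (show (1 - m) * F k 3 = 0 by linarith)).resolve_left hm'.ne'
    have := (coeff_eq_zero_of_vertices hS (α := 1) (β := b (i k)) (γ := c (i k)) (fun j => by
      fin_cases j
      exacts [e0, e1, e2, e3])).1
    exact one_ne_zero this
  set r : Fin 4 → ℝ := fun k => (P k)⁻¹ with hr
  have hrpos : ∀ k, 0 < r k := fun k => inv_pos.mpr (hPpos k)
  have hrP : ∀ k, r k * P k = 1 := fun k => inv_mul_cancel₀ (hPpos k).ne'
  have z00 : F 0 0 = 0 := hi 0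
  have z01 : F 0 1 = 0 := hi' 0
  have z11 : F 1 1 = 0 := hi 1
  have z12 : F 1 2 = 0 := hi' 1
  have z22 : F 2 2 = 0 := hi 2
  have z23 : F 2 3 = 0 := hi' 2
  have z33 : F 3 3 = 0 := hi 3
  have z30 : F 3 0 = 0 := hi' 3
  have key0 : ∀ k, l * (r k * F k 0) + (1 - l) * (r k * F k 2) = 1 := fun k => by
    have h : r k * (l * F k 0 + (1 - l) * F k 2) = 1 := hrP k
    linear_combination h
  have key1 : ∀ k, m * (r k * F k 1) + (1 - m) * (r k * F k 3) = 1 := fun k => by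
    have h := hrP k
    rw [hP' k] at h
    linear_combination h
  have n02 : r 0 * F 0 2 = (1 - l)⁻¹ := eq_inv_of_mul_eq_one_right (by simpa [z00] using key0 0)
  have n03 : r 0 * F 0 3 = (1 - m)⁻¹ := eq_inv_of_mul_eq_one_right (by simpa [z01] using key1 0)
  have n10 : r 1 * F 1 0 = l⁻¹ := eq_inv_of_mul_eq_one_right (by simpa [z12] using key0 1)
  have n13 : r 1 * F 1 3 = (1 - m)⁻¹ := eq_inv_of_mul_eq_one_right (by simpa [z11] using key1 1)
  have n20 : r 2 * F 2 0 = l⁻¹ := eq_inv_of_mul_eq_one_right (by simpa [z22] using key0 2)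
  have n21 : r 2 * F 2 1 = m⁻¹ := eq_inv_of_mul_eq_one_right (by simpa [z23] using key1 2)
  have n31 : r 3 * F 3 1 = m⁻¹ := eq_inv_of_mul_eq_one_right (by simpa [z33] using key1 3)
  have n32 : r 3 * F 3 2 = (1 - l)⁻¹ := eq_inv_of_mul_eq_one_right (by simpa [z30] using key0 3)
  have hzero : ∀ k j, F k j = 0 → j = k ∨ j = k + 1 := by
    have hne0 : ∀ k j x, r k * F k j = x⁻¹ → x ≠ 0 → F k j ≠ 0 := by
      intro k j x h hx h0
      rw [h0, mul_zero] at h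
      exact inv_ne_zero hx h.symm
    intro k j h
    fin_cases k <;> fin_cases j <;> first
      | exact Or.inl rfl
      | exact Or.inr rfl
      | exact absurd h (hne0 _ _ _ n02 hl'.ne')
      | exact absurd h (hne0 _ _ _ n03 hm'.ne')
      | exact absurd h (hne0 _ _ _ n10 hl0.ne')
      | exact absurd h (hne0 _ _ _ n13 hm'.ne')
      | exact absurd h (hne0 _ _ _ n20 hl0.ne')
      | exact absurd h (hne0 _ _ _ n21 hm0.ne')
      | exact absurd h (hne0 _ _ _ n31 hm0.ne')
      | exact absurd h (hne0 _ _ _ n32 hl'.ne')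
  -- Each form vanishes at no vertices but the ends of its edge, so distinct edges use distinct
  -- inequalities.
  have hinj : i.Injective := by
    intro k k' h
    have hFF : ∀ j, F k j = F k' j := fun j => by simp only [hF, h]
    have h1 := hzero k k' ((hFF k').trans (hi k'))
    have h2 := hzero k (k' + 1) ((hFF (k' + 1)).trans (hi' k'))
    have hcyc : ∀ k k' : Fin 4, k' = k ∨ k' = k + 1 → k' + 1 = k ∨ k' + 1 = k + 1 → k = k' := by
      decide
    exact hcyc k k' h1 h2
  have hcomb : ∀ x₀ x₁ x₂ x₃ y : ℝ, (∀ j, x₀ * (r 0 * F 0 j) + x₁ * (r 1 * F 1 j) +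
      x₂ * (r 2 * F 2 j) + x₃ * (r 3 * F 3 j) = y) →
      x₀ * r 0 + x₁ * r 1 + x₂ * r 2 + x₃ * r 3 = y ∧
      x₀ * (r 0 * b (i 0)) + x₁ * (r 1 * b (i 1)) + x₂ * (r 2 * b (i 2)) +
        x₃ * (r 3 * b (i 3)) = 0 ∧
      x₀ * (r 0 * c (i 0)) + x₁ * (r 1 * c (i 1)) + x₂ * (r 2 * c (i 2)) +
        x₃ * (r 3 * c (i 3)) = 0 := by
    intro x₀ x₁ x₂ x₃ y h
    have := coeff_eq_zero_of_vertices hS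
      (α := x₀ * r 0 + x₁ * r 1 + x₂ * r 2 + x₃ * r 3 - y) (β := _) (γ := _) (fun j => by
        have hj := h j
        simp only [hF, affineForm] at hj ⊢
        rw [← sub_eq_zero] at hj
        refine Eq.trans ?_ hj
        rw [show x₀ * (r 0 * (1 + b (i 0) * v j 0 + c (i 0) * v j 1)) +
          x₁ * (r 1 * (1 + b (i 1) * v j 0 + c (i 1) * v j 1)) +
          x₂ * (r 2 * (1 + b (i 2) * v j 0 + c (i 2) * v j 1)) +
          x₃ * (r 3 * (1 + b (i 3) * v j 0 + c (i 3) * v j 1)) - y =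
          (x₀ * r 0 + x₁ * r 1 + x₂ * r 2 + x₃ * r 3 - y) +
          (x₀ * (r 0 * b (i 0)) + x₁ * (r 1 * b (i 1)) + x₂ * (r 2 * b (i 2)) +
            x₃ * (r 3 * b (i 3))) * v j 0 +
          (x₀ * (r 0 * c (i 0)) + x₁ * (r 1 * c (i 1)) + x₂ * (r 2 * c (i 2)) +
            x₃ * (r 3 * c (i 3))) * v j 1 by ring])
    exact ⟨sub_eq_zero.mp this.1, this.2.1, this.2.2⟩
  obtain ⟨re, ru, rv⟩ := hcomb 1 (-1) 1 (-1) 0 (fun j => by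
    fin_cases j <;> simp only [Fin.zero_eta, Fin.mk_one, Fin.reduceFinMk, z00, z01, z11, z12, z22,
      z23, z33, z30, n02, n03, n10, n13, n20, n21, n31, n32] <;> ring)
  obtain ⟨oe, ou, ov⟩ := hcomb (1 - l) (l - m) m 0 1 (fun j => by
    fin_cases j <;> simp only [Fin.zero_eta, Fin.mk_one, Fin.reduceFinMk, z00, z01, z11, z12, z22,
      z23, z33, z30, n02, n03, n10, n13, n20, n21, n31, n32] <;> field_simp <;> ring)
  have hindep : r 0 * b (i 0) * (r 1 * c (i 1)) - r 1 * b (i 1) * (r 0 * c (i 0)) ≠ 0 := by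
    intro h
    have hd : b (i 0) * c (i 1) - b (i 1) * c (i 0) = 0 := by
      have : r 0 * r 1 * (b (i 0) * c (i 1) - b (i 1) * c (i 0)) = 0 := by linarith
      exact (mul_eq_zero.mp this).resolve_left (mul_pos (hrpos 0) (hrpos 1)).ne'
    have h0 : F 0 1 = 1 + b (i 0) * v 1 0 + c (i 0) * v 1 1 := rfl
    have h1 : F 1 1 = 1 + b (i 1) * v 1 0 + c (i 1) * v 1 1 := rfl
    rw [z01] at h0
    rw [z11] at h1
    have hb : b (i 0) = b (i 1) := by
      linear_combination b (i 1) * h0 - b (i 0) * h1 - v 1 1 * hd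
    have hc : c (i 0) = c (i 1) := by
      linear_combination c (i 1) * h0 - c (i 0) * h1 + v 1 0 * hd
    have : F 0 2 = 0 := by
      rw [← z12]
      simp only [hF, hb, hc]
    have := hzero 0 2 this
    revert this
    decide
  -- Here `c = m`, `a + c = 1 - l`, `b + c = l` and `a + b + c = 1 - m`, all positive because the
  -- intersection is interior to both diagonals.
  refine ⟨⟨r, fun k => r k * b (i k), fun k => r k * c (i k), 1 - l - m, l - m, m, hrpos,
    by linarith, by linarith, by linarith, by linarith, by linarith, by linarith, by ring,
    hm0, by linarith, by linarith, by linarith, hindep⟩,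
    Equiv.ofBijective i (Finite.injective_iff_bijective.mp hinj), fun k => ⟨hrpos k, rfl, rfl⟩⟩

theorem exists_quadPencil (hS : IsQuadrilateral (polygon b c)) :
    ∃ (T : QuadPencil) (τ : Equiv.Perm (Fin 4)), ∀ k, 0 < T.e k ∧
      T.u k = T.e k * b (τ k) ∧ T.v k = T.e k * c (τ k) := by
  obtain ⟨v, hv, hS⟩ := hS
  obtain ⟨σ, l, m, hl0, hl1, hm0, hm1, hrel⟩ := exists_diagonals_intersect hv
  exact exists_quadPencil_of_vertices (v := v ∘ σ) (by rw [hS, σ.surjective.range_comp])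
    hl0 hl1 hm0 hm1 hrel (hv.injective.comp σ.injective)

end Polygon

/-! ### From diagonal pencils to normalised forms. -/

theorem mem_freeSpectrahedron_iff_of_isDiag {B : MatTuple 2 4} (hB : ∀ i, (B i).IsDiag) {n : ℕ}
    (X : MatTuple 2 n) :
    X ∈ freeSpectrahedron B n ↔ (∀ i, (X i).IsSymm) ∧
      ∀ j, (1 + B 0 j j • X 0 + B 1 j j • X 1).PosSemidef := by
  refine and_congr_right fun _ => ⟨fun h j => ?_, fun h => ?_⟩
  · convert h.submatrix (Prod.mk j) using 1
    ext p q
    simp [monicPencil, Matrix.one_apply, Fin.sum_univ_two, add_assoc]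
  · have : monicPencil B X = ∑ j, Matrix.diagonal (Pi.single j (1 : ℝ)) ⊗ₖ
        (1 + B 0 j j • X 0 + B 1 j j • X 1) := by
      ext ⟨j, p⟩ ⟨k, q⟩
      simp only [monicPencil, Matrix.add_apply, Fin.sum_univ_two, Matrix.sum_apply,
        Matrix.kronecker_apply, Matrix.diagonal_apply, Matrix.smul_apply, smul_eq_mul]
      by_cases hjk : j = k
      · subst hjk
        rw [Finset.sum_eq_single j]
        · simp [Matrix.one_apply, add_assoc]
        · intro i _ hi
          simp [hi.symm]
        · simp
      · simp [hjk, hB 0 hjk, hB 1 hjk, Matrix.one_apply]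
    rw [this]
    refine Matrix.posSemidef_sum _ fun j _ => Matrix.PosSemidef.kronecker
      (Matrix.PosSemidef.diagonal fun i => ?_) (h j)
    rcases eq_or_ne i j with rfl | hij
    · simp
    · simp [hij]

theorem levelOne_freeSpectrahedron_of_isDiag {B : MatTuple 2 4} (hB : ∀ i, (B i).IsDiag) :
    levelOne (freeSpectrahedron B) = polygon (fun j => B 0 j j) (fun j => B 1 j j) := by
  ext x
  refine (mem_freeSpectrahedron_iff_of_isDiag hB _).trans ?_
  have hs : ∀ t : ℝ, (Matrix.of fun _ _ => t : Matrix (Fin 1) (Fin 1) ℝ).IsSymm := fun t => rfl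
  simp only [hs, implies_true, true_and]
  refine forall_congr' fun j => ?_
  have : (1 + B 0 j j • (Matrix.of fun _ _ => x 0) + B 1 j j • (Matrix.of fun _ _ => x 1) :
      Matrix (Fin 1) (Fin 1) ℝ) =
      Matrix.diagonal fun _ => affineForm 1 (B 0 j j) (B 1 j j) x := by
    ext p q
    obtain rfl := Subsingleton.elim p q
    simp [affineForm]
  rw [this, Matrix.posSemidef_diagonal_iff]
  simp

theorem exists_describes {d : ℕ} {A : MatTuple 2 d}
    (hQ : IsFreeQuadrilateral (freeSpectrahedron A)) : ∃ T : QuadPencil, T.Describes A := by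
  obtain ⟨hquad, B, hB, hAB⟩ := hQ
  rw [hAB, levelOne_freeSpectrahedron_of_isDiag hB] at hquad
  obtain ⟨T, τ, hT⟩ := exists_quadPencil hquad
  refine ⟨T, fun n X => ?_⟩
  rw [hAB, mem_freeSpectrahedron_iff_of_isDiag hB]
  refine and_congr_right fun _ => ?_
  have hform : ∀ k, T.form k X = T.e k • (1 + B 0 (τ k) (τ k) • X 0 + B 1 (τ k) (τ k) • X 1) := by
    intro k
    rw [QuadPencil.form, (hT k).2.1, (hT k).2.2]
    module
  constructor
  · intro h k
    rw [hform]
    exact (h (τ k)).smul (hT k).1.le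
  · intro h j
    have hj := (h (τ.symm j)).smul (inv_pos.mpr (hT (τ.symm j)).1).le
    rwa [hform, smul_smul, inv_mul_cancel₀ (hT _).1.ne', one_smul, Equiv.apply_symm_apply] at hj

/-! ### Degree bounds for noncommutative polynomials. -/

namespace NCPoly

variable {g : ℕ}

theorem degree_add_le {p q : NCPoly g} {k : ℕ} (hp : p.degree ≤ k) (hq : q.degree ≤ k) :
    NCPoly.degree (p + q) ≤ k := by
  classical
  unfold NCPoly.degree at *
  rw [map_add]
  refine (Finset.sup_mono Finsupp.support_add).trans ?_
  rw [Finset.sup_union]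
  exact sup_le hp hq

theorem degree_smul_le (t : ℝ) (p : NCPoly g) : NCPoly.degree (t • p) ≤ p.degree := by
  unfold NCPoly.degree
  rw [map_smul]
  exact Finset.sup_mono Finsupp.support_smul

theorem degree_mul_le (p q : NCPoly g) : NCPoly.degree (p * q) ≤ p.degree + q.degree := by
  classical
  unfold NCPoly.degree
  rw [map_mul]
  refine (Finset.sup_mono (MonoidAlgebra.support_coeff_mul_subset _ _)).trans
    (Finset.sup_le fun w hw => ?_)
  obtain ⟨x, hx, y, hy, rfl⟩ := Finset.mem_mul.mp hw
  rw [FreeMonoid.length_mul]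
  exact add_le_add (Finset.le_sup (f := FreeMonoid.length) hx)
    (Finset.le_sup (f := FreeMonoid.length) hy)

theorem degree_one_le : NCPoly.degree (1 : NCPoly g) ≤ 1 := by
  unfold NCPoly.degree
  rw [map_one, Finset.sup_le_iff]
  intro w hw
  have := Finsupp.support_single_subset hw
  rw [Finset.mem_singleton] at this
  simp [this]

theorem degree_ι_le (i : Fin g) : NCPoly.degree (FreeAlgebra.ι ℝ i : NCPoly g) ≤ 1 := by
  unfold NCPoly.degree
  rw [Finset.sup_le_iff]
  intro w hw
  have h : FreeAlgebra.equivMonoidAlgebraFreeMonoid (FreeAlgebra.ι ℝ i : NCPoly g) =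
      MonoidAlgebra.of ℝ (FreeMonoid (Fin g)) (FreeMonoid.of i) :=
    FreeAlgebra.lift_ι_apply _ _
  rw [h] at hw
  have := Finsupp.support_single_subset hw
  rw [Finset.mem_singleton] at this
  simp [this]

end NCPoly

/-! ### The two defining cubics. -/

namespace QuadPencil

variable (T : QuadPencil)

/-- The `j`-th affine form as a noncommutative polynomial. -/
def formPoly (j : Fin 4) : NCPoly 2 :=
  T.e j • 1 + T.u j • FreeAlgebra.ι ℝ 0 + T.v j • FreeAlgebra.ι ℝ 1

/-- The cubic expressing that the first pair of opposite forms is complementary. -/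
def cubic : NCPoly 2 :=
  T.formPoly 0 * ((T.c * (T.a + T.c)) • T.formPoly 3 +
    (T.c * (T.a + T.c) + T.b) • T.formPoly 1) * T.formPoly 2

theorem degree_formPoly_le (j : Fin 4) : (T.formPoly j).degree ≤ 1 :=
  NCPoly.degree_add_le (NCPoly.degree_add_le
    ((NCPoly.degree_smul_le _ _).trans NCPoly.degree_one_le)
    ((NCPoly.degree_smul_le _ _).trans (NCPoly.degree_ι_le _)))
    ((NCPoly.degree_smul_le _ _).trans (NCPoly.degree_ι_le _))

theorem degree_cubic_le : T.cubic.degree ≤ 3 := by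
  have h := NCPoly.degree_add_le
    ((NCPoly.degree_smul_le (T.c * (T.a + T.c)) _).trans (T.degree_formPoly_le 3))
    ((NCPoly.degree_smul_le (T.c * (T.a + T.c) + T.b) _).trans (T.degree_formPoly_le 1))
  refine (NCPoly.degree_mul_le _ _).trans (add_le_add ((NCPoly.degree_mul_le _ _).trans
    (add_le_add (T.degree_formPoly_le 0) h)) (T.degree_formPoly_le 2))

theorem eval_formPoly {n : ℕ} (j : Fin 4) (X : MatTuple 2 n) :
    (T.formPoly j).eval X = T.form j X := by
  simp [NCPoly.eval, formPoly, form]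

theorem eval_cubic {n : ℕ} (X : MatTuple 2 n) :
    T.cubic.eval X = T.form 0 X * ((T.c * (T.a + T.c)) • T.form 3 X +
      (T.c * (T.a + T.c) + T.b) • T.form 1 X) * T.form 2 X := by
  simp_rw [← eval_formPoly]
  simp [NCPoly.eval, cubic]

variable {T} {d n : ℕ} {A : MatTuple 2 d}

theorem Describes.complementary_of_eval_cubic (hT : T.Describes A) {X : MatTuple 2 n}
    (hX : X ∈ freeSpectrahedron A n) (h : T.cubic.eval X = 0) :
    T.form 0 X * (T.form 0 X + T.form 2 X)⁻¹ * T.form 2 X = 0 := by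
  rw [eval_cubic] at h
  refine complementary_of_mul_mul_eq_zero (L := fun j => T.form j X) ((hT n X).mp hX).2
    (T.form_add_form X) (T.combination_eq_one X) (mul_pos T.c_pos T.ac_pos) ?_ h
  -- Positivity of the second coefficient is visible only after factoring it with `a + b + 2c = 1`.
  have h1 : T.c * (T.a + T.c) + T.b = (T.b + T.c) * (T.a + T.b + T.c) := by
    have hs := T.sum_eq
    linear_combination (-T.b) * hs
  rw [h1]
  exact mul_pos T.bc_pos T.abc_pos

theorem Describes.eval_cubic_eq_zero (hT : T.Describes A) {X : MatTuple 2 n}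
    (hX : X ∈ freeSpectrahedron A n)
    (h02 : T.form 0 X * (T.form 0 X + T.form 2 X)⁻¹ * T.form 2 X = 0)
    (h13 : T.form 1 X * (T.form 0 X + T.form 2 X)⁻¹ * T.form 3 X = 0) : T.cubic.eval X = 0 := by
  rw [eval_cubic]
  exact mul_mul_eq_zero_of_complementary (L := fun j => T.form j X) ((hT n X).mp hX).2
    (T.form_add_form X) (T.combination_eq_one X) T.sum_eq T.c_pos T.ac_pos T.bc_pos T.abc_pos
    h02 h13

theorem Describes.mem_arvesonBoundary_iff (hT : T.Describes A) (X : MatTuple 2 n) :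
    X ∈ arvesonBoundary (freeSpectrahedron A) n ↔
      X ∈ freeSpectrahedron A n ∧ T.cubic.eval X = 0 ∧ T.swap.cubic.eval X = 0 := by
  have hsum : T.swap.form 0 X + T.swap.form 2 X = T.form 0 X + T.form 2 X :=
    (T.form_add_form X).symm
  constructor
  · intro h
    have h02 := hT.complementary_of_mem_arvesonBoundary h
    have h13 := hT.swap.complementary_of_mem_arvesonBoundary h
    have h02' := h02
    rw [← hsum] at h02'
    refine ⟨h.1, hT.eval_cubic_eq_zero h.1 h02 ?_, hT.swap.eval_cubic_eq_zero h.1 h13 h02'⟩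
    rw [hsum] at h13
    exact h13
  · rintro ⟨hX, h1, h2⟩
    have h13 := hT.swap.complementary_of_eval_cubic hX h2
    rw [hsum] at h13
    exact hT.mem_arvesonBoundary hX (hT.complementary_of_eval_cubic hX h1) h13

end QuadPencil

end FreeQuad

theorem theorem1p3 {d : ℕ} (A : FreeQuad.MatTuple 2 d) (hA : ∀ i, (A i).IsSymm)
    (hQ : FreeQuad.IsFreeQuadrilateral (FreeQuad.freeSpectrahedron A)) :
    ∃ p : Fin 4 → FreeQuad.NCPoly 2,
      (∀ j, (p j).degree ≤ 3) ∧
      (∀ (n : ℕ), 0 < n → ∀ X : FreeQuad.MatTuple 2 n,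
        X ∈ FreeQuad.arvesonBoundary (FreeQuad.freeSpectrahedron A) n ↔
          X ∈ FreeQuad.freeSpectrahedron A n ∧ ∀ j, (p j).eval X = 0) ∧
      (∀ (n : ℕ), 0 < n → ∀ X : FreeQuad.MatTuple 2 n,
        X ∈ FreeQuad.freeExtremePoints (FreeQuad.freeSpectrahedron A) n ↔
          X ∈ FreeQuad.freeSpectrahedron A n ∧ (∀ j, (p j).eval X = 0) ∧
            FreeQuad.IsIrreducible X) := by
  obtain ⟨T, hT⟩ := FreeQuad.exists_describes hQ
  have hArv : ∀ (n : ℕ) (X : FreeQuad.MatTuple 2 n),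
      X ∈ FreeQuad.arvesonBoundary (FreeQuad.freeSpectrahedron A) n ↔
        X ∈ FreeQuad.freeSpectrahedron A n ∧
          -- Two cubics suffice; repetition fills the four places.
          ∀ j, (![T.cubic, T.swap.cubic, T.cubic, T.swap.cubic] j).eval X = 0 := by
    intro n X
    rw [hT.mem_arvesonBoundary_iff]
    refine and_congr_right fun _ => ⟨fun h j => ?_, fun h => ⟨h 0, h 1⟩⟩
    fin_cases j
    exacts [h.1, h.2, h.1, h.2]
  refine ⟨_, fun j => ?_, fun n _ => hArv n, fun n hn X => ?_⟩
  · fin_cases j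
    exacts [T.degree_cubic_le, T.swap.degree_cubic_le, T.degree_cubic_le, T.swap.degree_cubic_le]
  · rw [FreeQuad.mem_freeExtremePoints_iff A hn, hArv, and_assoc]
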